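/- **Conventions.** For $0<q\le\infty$ and an interval $I\subset(0,\infty)$, $\|F\|_{q,I}$ is the (quasi-)norm of $L_q(I)$ with respect to Lebesgue measure, with values in $[0,\infty]$, and $1/\infty=0$. A positive Lebesgue measurable function $b$ on $(0,\infty)$ is slowly varying, $b\in SV$, if for every $\varepsilon>0$ the function $t^{\varepsilon}b(t)$ is equivalent (up to multiplicative constants) to a non-decreasing function and $t^{-\varepsilon}b(t)$ is equivalent to a non-increasing function. Let $\bar A=(A_0,A_1)$ be a compatible couple of (real or complex) quasi-Banach spaces, i.e. both are continuously embedded in a common Hausdorff topological vector space, with $A_0\cap A_1\ne\{0\}$. For $f\in A_0+A_1$ and $t>0$ put $K(t,f)=K(t,f;A_0,A_1)=\inf\{\|f_0\|_{A_0}+t\|f_1\|_{A_1}: f=f_0+f_1,\ f_i\in A_i\}$. For positive functions $a,b,c$ on $(0,\infty)$, $0\le\theta\le1$ and $0<q,r,s\le\infty$, the following spaces consist of all $f\in A_0+A_1$ for which the indicated quasi-norm is finite: $$\bar A_{\theta,q;b}=(A_0,A_1)_{\theta,q;b}:\quad \big\|u^{-\theta-1/q}b(u)K(u,f)\big\|_{q,(0,\infty)},$$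 $$\bar A^{\mathcal R}_{\theta,r,b,q,a}:\quad \Big\|t^{-1/r}b(t)\big\|u^{-\theta-1/q}a(u)K(u,f)\big\|_{q,(t,\infty)}\Big\|_{r,(0,\infty)},$$ $$\bar A^{\mathcal R,\mathcal R}_{\theta,s,c,r,b,q,a}:\quad \Big\|t^{-1/s}c(t)\Big\|u^{-1/r}b(u)\big\|v^{-\theta-1/q}a(v)K(v,f)\big\|_{q,(u,\infty)}\Big\|_{r,(t,\infty)}\Big\|_{s,(0,\infty)}.$$ The notation $(A_0,X)_{\theta,q;b}$ is used in the same way for any quasi-normed space $X\subset A_0+A_1$, with the functional $K(\cdot,\cdot;A_0,X)$. Equality of spaces means that they have the same elements and equivalent quasi-norms; an intersection carries the maximum of the quasi-norms. **Theorem.** Let $0<q_1,r_1,r\le\infty$ and $a_1,b_1,a\in SV$, and assume $$\Big\|s^{-1/r_1}b_1(s)\big\|u^{-1/q_1}a_1(u)\big\|_{q_1,(s,1)}\Big\|_{r_1,(0,1)}<\infty .$$ For $t>0$ and $0\le\theta\le1$ put $$\chi_1(t)=\Big\|s^{-1/r_1}b_1(s)\big\|u^{-1/q_1}a_1(u)\big\|_{q_1,(s,t)}\Big\|_{r_1,(0,t)},\qquad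 \rho(t)=\frac{t}{\chi_1(t)},\qquad a^{\#}(t)=\chi_1(t)^{\theta}\,a(\rho(t)).$$ (i) If $0<\theta<1$, then $\big(A_0,\bar A^{\mathcal R}_{1,r_1,b_1,q_1,a_1}\big)_{\theta,r;a}=\bar A_{\theta,r;a^{\#}}$. (ii) If $\|s^{-1/r}a(s)\|_{r,(1,\infty)}<\infty$, then $\big(A_0,\bar A^{\mathcal R}_{1,r_1,b_1,q_1,a_1}\big)_{0,r;a}=\bar A_{0,r;a\circ\rho}$. (iii) If $\|s^{-1/r}a(s)\|_{r,(0,1)}<\infty$, then (with $\theta=1$ in $a^{\#}$) $$\big(A_0,\bar A^{\mathcal R}_{1,r_1,b_1,q_1,a_1}\big)_{1,r;a}=\bar A_{1,r;a^{\#}}\cap\bar A^{\mathcal R}_{1,r,B_1,q_1,a_1}\cap\bar A^{\mathcal R,\mathcal R}_{1,r,a\circ\rho,r_1,b_1,q_1,a_1},$$ where $B_1(t)=\|s^{-1/r_1}b_1(s)\|_{r_1,(0,t)}\,a(\rho(t))$. -/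

import Mathlib

open MeasureTheory Set Filter Topology
open scoped ENNReal NNReal

/-- A quasi-Banach space `A` that is continuously and linearly embedded in the topological vector
space `V`, encoded by its extended quasi-norm `A : V → [0, ∞]`: the space itself is
`{f | A f < ∞}` and `A f` is the quasi-norm of its element `f`. -/
structure IsQuasiBanachSubspace (𝕜 : Type*) [RCLike 𝕜] {V : Type*} [AddCommGroup V] [Module 𝕜 V]
    [TopologicalSpace V] (A : V → ℝ≥0∞) : Prop where
  eq_zero_iff : ∀ f : V, A f = 0 ↔ f = 0
  smul_eq : ∀ (c : 𝕜) (f : V), A (c • f) = ‖c‖ₑ * A f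
  quasi_triangle : ∃ C : ℝ≥0, 1 ≤ C ∧ ∀ f g : V, A (f + g) ≤ C * (A f + A g)
  continuous_embedding : ∀ U ∈ 𝓝 (0 : V), ∃ ε : ℝ≥0∞, 0 < ε ∧ ∀ f : V, A f < ε → f ∈ U
  complete : ∀ u : ℕ → V, (∀ n, A (u n) < ∞) →
    (∀ ε : ℝ≥0∞, 0 < ε → ∃ N : ℕ, ∀ m ≥ N, ∀ n ≥ N, A (u m - u n) < ε) →
    ∃ f : V, A f < ∞ ∧ Tendsto (fun n => A (u n - f)) atTop (𝓝 0)

/-- `X ⊂ Y` with a continuous embedding, for spaces given by their extended quasi-norms. -/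
def ContEmbedded {V : Type*} (X Y : V → ℝ≥0∞) : Prop :=
  ∃ C : ℝ≥0, ∀ f : V, X f < ∞ → Y f ≤ C * X f

/-- `X = Y`: the same elements and equivalent quasi-norms. -/
def SameSpace {V : Type*} (X Y : V → ℝ≥0∞) : Prop :=
  ContEmbedded X Y ∧ ContEmbedded Y X

/-- The intersection `X ∩ Y`, with the quasi-norm `max (‖f‖_X, ‖f‖_Y)`. -/
def interSpace {V : Type*} (X Y : V → ℝ≥0∞) : V → ℝ≥0∞ :=
  fun f => max (X f) (Y f)

/-- Equivalence `f ≈ g` of functions on `(0, ∞)`. -/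
def EquivOnPos (f g : ℝ → ℝ) : Prop :=
  ∃ C : ℝ, 0 < C ∧ ∀ t : ℝ, 0 < t → f t ≤ C * g t ∧ g t ≤ C * f t

/-- `b ∈ SV`: slowly varying functions on `(0, ∞)`; the values of `b` off `(0, ∞)` play no role.
(A function is Lebesgue measurable on `(0, ∞)` iff it is a.e. equal to a Borel function there.) -/
structure IsSlowlyVarying (b : ℝ → ℝ) : Prop where
  pos : ∀ t : ℝ, 0 < t → 0 < b t
  measurable : AEMeasurable b (volume.restrict (Ioi 0))
  increasing : ∀ ε : ℝ, 0 < ε →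
    ∃ g : ℝ → ℝ, MonotoneOn g (Ioi 0) ∧ EquivOnPos (fun t => t ^ ε * b t) g
  decreasing : ∀ ε : ℝ, 0 < ε →
    ∃ g : ℝ → ℝ, AntitoneOn g (Ioi 0) ∧ EquivOnPos (fun t => t ^ (-ε) * b t) g

/-- `‖F‖_{q, I}`: the (quasi-)norm of `L_q` on the set `I ⊆ ℝ`, with value `∞` allowed. -/
noncomputable def lqNorm (q : ℝ≥0∞) (I : Set ℝ) (F : ℝ → ℝ≥0∞) : ℝ≥0∞ :=
  eLpNorm F q (volume.restrict I)

/-- The weight `u ^ (-θ - 1/q) * b u`. For `q = ∞` one has `q.toReal = 0`, so that `1/q = 0`. -/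
noncomputable def weight (θ : ℝ) (q : ℝ≥0∞) (b : ℝ → ℝ) (u : ℝ) : ℝ≥0∞ :=
  ENNReal.ofReal (u ^ (-θ - 1 / q.toReal) * b u)

/-- Peetre's functional `K(t, f; A₀, A₁)`. It is `∞` iff `f ∉ A₀ + A₁` (for `t > 0`). -/
noncomputable def peetreK {V : Type*} [AddCommGroup V] (A₀ A₁ : V → ℝ≥0∞) (t : ℝ) (f : V) :
    ℝ≥0∞ :=
  ⨅ (f₀ : V) (f₁ : V) (_ : f₀ + f₁ = f), A₀ f₀ + ENNReal.ofReal t * A₁ f₁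

/- In the next three definitions the spaces are given by their extended quasi-norms. For weights
that are positive on `(0, ∞)` these are `∞` whenever `f ∉ A₀ + A₁`. -/

/-- The standard space `(A₀, A₁)_{θ,q;b}`. -/
noncomputable def stdSpace {V : Type*} [AddCommGroup V] (A₀ A₁ : V → ℝ≥0∞)
    (θ : ℝ) (q : ℝ≥0∞) (b : ℝ → ℝ) : V → ℝ≥0∞ :=
  fun f => lqNorm q (Ioi 0) (fun u => weight θ q b u * peetreK A₀ A₁ u f)

/-- The limiting space `(A₀, A₁)^R_{θ,r,b,q,a}`. -/
noncomputable def spaceR {V : Type*} [AddCommGroup V] (A₀ A₁ : V → ℝ≥0∞)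
    (θ : ℝ) (r : ℝ≥0∞) (b : ℝ → ℝ) (q : ℝ≥0∞) (a : ℝ → ℝ) : V → ℝ≥0∞ :=
  fun f => lqNorm r (Ioi 0) (fun t => weight 0 r b t *
    lqNorm q (Ioi t) (fun u => weight θ q a u * peetreK A₀ A₁ u f))

/-- The extremal space `(A₀, A₁)^{R,R}_{θ,s,c,r,b,q,a}`. -/
noncomputable def spaceRR {V : Type*} [AddCommGroup V] (A₀ A₁ : V → ℝ≥0∞)
    (θ : ℝ) (s : ℝ≥0∞) (c : ℝ → ℝ) (r : ℝ≥0∞) (b : ℝ → ℝ) (q : ℝ≥0∞) (a : ℝ → ℝ) :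
    V → ℝ≥0∞ :=
  fun f => lqNorm s (Ioi 0) (fun t => weight 0 s c t *
    lqNorm r (Ioi t) (fun u => weight 0 r b u *
      lqNorm q (Ioi u) (fun v => weight θ q a v * peetreK A₀ A₁ v f)))

/-- `‖s^{-1/r} b(s) ‖u^{-1/q} a(u)‖_{q,(s,t)}‖_{r,(0,t)}`. -/
noncomputable def nestedNorm (r : ℝ≥0∞) (b : ℝ → ℝ) (q : ℝ≥0∞) (a : ℝ → ℝ) (t : ℝ) : ℝ≥0∞ :=
  lqNorm r (Ioo 0 t) (fun s => weight 0 r b s * lqNorm q (Ioo s t) (weight 0 q a))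

/-- `χ₁(t) = ‖s^{-1/r₁} b₁(s) ‖u^{-1/q₁} a₁(u)‖_{q₁,(s,t)}‖_{r₁,(0,t)}` as a real number; for slowly
varying `a₁`, `b₁` it is positive and finite at every `t > 0` as soon as it is finite at `t = 1`. -/
noncomputable def chiOne (r₁ : ℝ≥0∞) (b₁ : ℝ → ℝ) (q₁ : ℝ≥0∞) (a₁ : ℝ → ℝ) (t : ℝ) : ℝ :=
  (nestedNorm r₁ b₁ q₁ a₁ t).toReal

/-- `ρ(t) = t / χ₁(t)`. -/
noncomputable def rhoOne (r₁ : ℝ≥0∞) (b₁ : ℝ → ℝ) (q₁ : ℝ≥0∞) (a₁ : ℝ → ℝ) (t : ℝ) : ℝ :=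
  t / chiOne r₁ b₁ q₁ a₁ t

/-- `a# = χ₁ ^ θ · (a ∘ ρ)`. -/
noncomputable def aSharp (r₁ : ℝ≥0∞) (b₁ : ℝ → ℝ) (q₁ : ℝ≥0∞) (a₁ : ℝ → ℝ) (a : ℝ → ℝ)
    (θ : ℝ) (t : ℝ) : ℝ :=
  chiOne r₁ b₁ q₁ a₁ t ^ θ * a (rhoOne r₁ b₁ q₁ a₁ t)

/-- `B₁(t) = ‖s^{-1/r₁} b₁(s)‖_{r₁,(0,t)} · a(ρ(t))`; the norm is finite whenever `χ₁` is. -/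
noncomputable def bigBOne (r₁ : ℝ≥0∞) (b₁ : ℝ → ℝ) (q₁ : ℝ≥0∞) (a₁ : ℝ → ℝ) (a : ℝ → ℝ)
    (t : ℝ) : ℝ :=
  (lqNorm r₁ (Ioo 0 t) (weight 0 r₁ b₁)).toReal * a (rhoOne r₁ b₁ q₁ a₁ t)

/-! Put X = A^R_{1,r₁,b₁,q₁,a₁} and write K(t) for K(t, f; A₀, A₁). Against the measure du/u the
factors u^{-1/q} disappear and every norm becomes dilation-invariant. The theorem rests on a
Holmstedt-type formula (`exists_holmstedt`): (χ₁(t)/t) K(ρ(t), f; A₀, X) ≈ (χ₁(t)/t) K(t) +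
‖b₁‖_{r₁,(0,t)} · ‖u⁻¹ a₁ K‖_{q₁,(t,∞)} + ‖b₁(s) ‖u⁻¹ a₁ K‖_{q₁,(s,∞)}‖_{r₁,(t,∞)}. For the upper
bound, a decomposition f = f₀ + f₁ that serves for K(t) also serves for K(ρ(t), f; A₀, X). The
X-norm of f₁ is split at t: below t one uses K(u, f₁) ≤ (u/t) M, above t one uses K(u, f₁) ≤ c (K(u)
+ M), where M = ‖f₀‖ + t‖f₁‖. For the lower bound the decomposition is arbitrary, and (u/t) K(t, g)
≤ K(u, g) for u ≤ t puts each of the three terms for g below ‖g‖_X. Both halves are inequalities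
between functions on the half-line: `exists_iteratedTailNorm_zero_le` and
`exists_le_iteratedTailNorm_zero`. The errors caused by M are absorbed through a₁(t) ‖b₁‖_{r₁,(0,t)}
≤ C χ₁(t) and b₁(t) ≤ C ‖b₁‖_{r₁,(0,t)}.

The norm of (A₀, X)_{θ,r;a} is then pulled back along v = ρ(t). The function ρ need be neither
continuous nor monotone; it is enough that it grows at most like t and at least like t^{1/2}
(`IsRegularVariable`). A Schur-type argument then compares the norms of F and F ∘ ρ whenever F is
almost constant at bounded ratios (`exists_logNorm_comp_le`, `exists_logNorm_le_comp`).

The result is a sum of three norms with the common weight ρ^{1-θ} a(ρ) (`exists_stdSpace_equiv`),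
the first being the norm of A_{θ,r;a#}. For θ < 1 the weight grows like a positive power, and a
Hardy inequality (`exists_hardy`) bounds the two tail terms by the first; this covers θ = 0 as well.
For θ = 1 the power is gone, and the three terms are exactly the norms of the three spaces in the
intersection. -/

/-! ### The measure `du / u` and its `L_q` functionals -/

/-- The Haar measure `du / u` of the multiplicative group `(0, ∞)`. -/
noncomputable def logMeasure : Measure ℝ :=
  (volume.restrict (Ioi 0)).withDensity (fun u => ENNReal.ofReal u⁻¹)

/-- The (quasi-)norm of `L_q(I, du / u)`. -/
noncomputable def logNorm (q : ℝ≥0∞) (I : Set ℝ) (F : ℝ → ℝ≥0∞) : ℝ≥0∞ :=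
  eLpNorm F q (logMeasure.restrict I)

/-- The substitution u = exp x has Jacobian exp x, which cancels the density 1/u. Dilation
invariance thus becomes translation invariance of Lebesgue measure, and logarithmic lengths of
intervals become ordinary lengths. -/
theorem logMeasure_eq_map_exp : logMeasure = Measure.map Real.exp volume := by
  ext s hs
  rw [Measure.map_apply Real.measurable_exp hs, logMeasure, withDensity_apply _ hs,
    Measure.restrict_restrict hs]
  have himg : Real.exp '' (Real.exp ⁻¹' s) = s ∩ Ioi 0 := by
    rw [image_preimage_eq_inter_range, Real.range_exp]
  rw [← himg, lintegral_image_eq_lintegral_abs_deriv_mul (f' := Real.exp)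
    (Real.measurable_exp hs) (fun x _ => (Real.hasDerivAt_exp x).hasDerivWithinAt)
    Real.exp_injective.injOn]
  rw [← setLIntegral_one]
  refine setLIntegral_congr_fun (Real.measurable_exp hs) fun x _ => ?_
  rw [← ENNReal.ofReal_mul (abs_nonneg _), abs_of_pos (Real.exp_pos x),
    mul_inv_cancel₀ (Real.exp_pos x).ne', ENNReal.ofReal_one]

instance : SFinite logMeasure := by
  rw [logMeasure_eq_map_exp]; infer_instance

theorem logMeasure_restrict_Ioi_zero : logMeasure.restrict (Ioi 0) = logMeasure := by
  rw [logMeasure, restrict_withDensity measurableSet_Ioi,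
    Measure.restrict_restrict measurableSet_Ioi, inter_self]

theorem logMeasure_absolutelyContinuous : logMeasure ≪ volume.restrict (Ioi 0) :=
  withDensity_absolutelyContinuous _ _

theorem absolutelyContinuous_logMeasure : volume.restrict (Ioi (0 : ℝ)) ≪ logMeasure := by
  refine withDensity_absolutelyContinuous' (by fun_prop) ?_
  filter_upwards [ae_restrict_mem measurableSet_Ioi] with u hu
  simpa using hu

theorem ae_pos_logMeasure (I : Set ℝ) : ∀ᵐ u ∂(logMeasure.restrict I), 0 < u :=
  ae_restrict_of_ae (logMeasure_absolutelyContinuous.ae_le (ae_restrict_mem measurableSet_Ioi))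

theorem setLIntegral_logMeasure {s : Set ℝ} (hs : s ⊆ Ioi 0) (hsm : MeasurableSet s)
    (F : ℝ → ℝ≥0∞) :
    ∫⁻ u in s, F u ∂logMeasure = ∫⁻ u in s, ENNReal.ofReal u⁻¹ * F u := by
  rw [logMeasure, setLIntegral_withDensity_eq_setLIntegral_mul_non_measurable _ (by fun_prop) _
    hsm (by simp), Measure.restrict_restrict hsm, inter_eq_left.2 hs]
  rfl

theorem logMeasure_Ioo {s t : ℝ} (hs : 0 < s) (ht : 0 < t) :
    logMeasure (Ioo s t) = ENNReal.ofReal (Real.log t - Real.log s) := by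
  rw [logMeasure_eq_map_exp, Measure.map_apply Real.measurable_exp measurableSet_Ioo]
  have : Real.exp ⁻¹' Ioo s t = Ioo (Real.log s) (Real.log t) := by
    ext x
    simp [Real.log_lt_iff_lt_exp hs, Real.lt_log_iff_exp_lt ht]
  rw [this, Real.volume_Ioo]

theorem measurePreserving_mul_left_logMeasure {c : ℝ} (hc : 0 < c) :
    MeasurePreserving (fun u => c * u) logMeasure logMeasure := by
  refine ⟨by fun_prop, ?_⟩
  rw [logMeasure_eq_map_exp, Measure.map_map (by fun_prop) Real.measurable_exp]
  have : (fun u => c * u) ∘ Real.exp = Real.exp ∘ fun x => Real.log c + x := by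
    funext x
    simp [Real.exp_add, Real.exp_log hc]
  rw [this, ← Measure.map_map Real.measurable_exp (by fun_prop),
    map_add_left_eq_self]

/-- For finite q the q-th power of u^{-1/q} is the density of du/u. For q = ∞ the factor is 1,
because `ENNReal.toReal` sends ∞ to 0 and division by 0 gives 0, and the two measures have the same
null sets in (0, ∞). -/
theorem eLpNorm_eq_logNorm {q : ℝ≥0∞} (hq : 0 < q) {s : Set ℝ} (hs : s ⊆ Ioi 0)
    (hsm : MeasurableSet s) (F G : ℝ → ℝ≥0∞)
    (h : ∀ u ∈ s, F u = ENNReal.ofReal (u ^ (-(1 / q.toReal))) * G u) :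
    eLpNorm F q (volume.restrict s) = logNorm q s G := by
  have hvol : (volume.restrict (Ioi (0 : ℝ))).restrict s = volume.restrict s := by
    rw [Measure.restrict_restrict hsm, inter_eq_left.2 hs]
  rcases eq_or_ne q ∞ with rfl | hq'
  · rw [logNorm, eLpNorm_exponent_top, eLpNorm_exponent_top, eLpNormEssSup, eLpNormEssSup]
    have hae : ae (volume.restrict s) = ae (logMeasure.restrict s) := by
      rw [← hvol]
      exact le_antisymm (absolutelyContinuous_logMeasure.restrict s).ae_le
        (logMeasure_absolutelyContinuous.restrict s).ae_le
    rw [essSup, essSup, ← hae]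
    refine limsup_congr ?_
    filter_upwards [ae_restrict_mem hsm] with u hu
    rw [h u hu]
    simp
  · have hr : 0 < q.toReal := ENNReal.toReal_pos hq.ne' hq'
    rw [logNorm, eLpNorm_eq_lintegral_rpow_enorm_toReal hq.ne' hq',
      eLpNorm_eq_lintegral_rpow_enorm_toReal hq.ne' hq', setLIntegral_logMeasure hs hsm]
    congr 1
    refine setLIntegral_congr_fun hsm fun u hu => ?_
    have hu0 : 0 < u := hs hu
    simp only [enorm_eq_self]
    rw [h u hu, ENNReal.mul_rpow_of_nonneg _ _ hr.le,
      ENNReal.ofReal_rpow_of_pos (Real.rpow_pos_of_pos hu0 _), ← Real.rpow_mul hu0.le]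
    congr 3
    rw [neg_mul, one_div, inv_mul_cancel₀ hr.ne', Real.rpow_neg_one]

theorem weight_eq {θ : ℝ} {q : ℝ≥0∞} {b : ℝ → ℝ} {u : ℝ} (hu : 0 < u) :
    weight θ q b u = ENNReal.ofReal (u ^ (-(1 / q.toReal))) *
      (ENNReal.ofReal (u ^ (-θ)) * ENNReal.ofReal (b u)) := by
  rw [weight, ← ENNReal.ofReal_mul (by positivity), ← ENNReal.ofReal_mul (by positivity),
    ← mul_assoc, ← Real.rpow_add hu]
  congr 3
  ring

theorem lqNorm_weight_mul {θ : ℝ} {q : ℝ≥0∞} (hq : 0 < q) {s : Set ℝ} (hs : s ⊆ Ioi 0)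
    (hsm : MeasurableSet s) (b : ℝ → ℝ) (F : ℝ → ℝ≥0∞) :
    lqNorm q s (fun u => weight θ q b u * F u) =
      logNorm q s (fun u => ENNReal.ofReal (u ^ (-θ)) * ENNReal.ofReal (b u) * F u) := by
  refine eLpNorm_eq_logNorm hq hs hsm _ _ fun u hu => ?_
  rw [weight_eq (hs hu), mul_assoc]

theorem lqNorm_weight_zero_mul {q : ℝ≥0∞} (hq : 0 < q) {s : Set ℝ} (hs : s ⊆ Ioi 0)
    (hsm : MeasurableSet s) (b : ℝ → ℝ) (F : ℝ → ℝ≥0∞) :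
    lqNorm q s (fun u => weight 0 q b u * F u) =
      logNorm q s (fun u => ENNReal.ofReal (b u) * F u) := by
  simpa using lqNorm_weight_mul (θ := 0) hq hs hsm b F

theorem lqNorm_weight_zero {q : ℝ≥0∞} (hq : 0 < q) {s : Set ℝ} (hs : s ⊆ Ioi 0)
    (hsm : MeasurableSet s) (b : ℝ → ℝ) :
    lqNorm q s (weight 0 q b) = logNorm q s (fun u => ENNReal.ofReal (b u)) := by
  simpa using lqNorm_weight_zero_mul hq hs hsm b (fun _ => 1)

/-! ### Elementary properties of `logNorm` -/

section logNorm

variable {q : ℝ≥0∞} {I J : Set ℝ} {F G : ℝ → ℝ≥0∞}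

theorem logNorm_mono (hI : MeasurableSet I) (h : ∀ u ∈ I, 0 < u → F u ≤ G u) :
    logNorm q I F ≤ logNorm q I G := by
  refine eLpNorm_mono_enorm_ae ?_
  filter_upwards [ae_restrict_mem hI, ae_pos_logMeasure I] with u hu hu0
  simpa using h u hu hu0

theorem logNorm_congr (hI : MeasurableSet I) (h : ∀ u ∈ I, 0 < u → F u = G u) :
    logNorm q I F = logNorm q I G :=
  le_antisymm (logNorm_mono hI fun u hu h0 => (h u hu h0).le)
    (logNorm_mono hI fun u hu h0 => (h u hu h0).ge)

theorem logNorm_mono_set (h : I ⊆ J) : logNorm q I F ≤ logNorm q J F :=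
  eLpNorm_mono_measure _ (Measure.restrict_mono h le_rfl)

theorem logNorm_const_mul {c : ℝ≥0∞} (hc : c ≠ ∞) :
    logNorm q I (fun u => c * F u) = c * logNorm q I F := by
  rcases eq_or_ne q 0 with rfl | hq
  · simp [logNorm]
  rcases eq_or_ne q ∞ with rfl | hq'
  · simp only [logNorm, eLpNorm_exponent_top, eLpNormEssSup, enorm_eq_self]
    exact ENNReal.essSup_const_mul
  · have hr : 0 < q.toReal := ENNReal.toReal_pos hq hq'
    simp only [logNorm, eLpNorm_eq_lintegral_rpow_enorm_toReal hq hq', enorm_eq_self,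
      ENNReal.mul_rpow_of_nonneg _ _ hr.le]
    rw [lintegral_const_mul' _ _ (ENNReal.rpow_ne_top_of_nonneg hr.le hc),
      ENNReal.mul_rpow_of_nonneg _ _ (by positivity), ← ENNReal.rpow_mul,
      mul_one_div_cancel hr.ne', ENNReal.rpow_one]

/-- Here c = ∞ is allowed, at the price of measurability of F. This matters because quasi-norms and
values of K enter later as constants and may be infinite. -/
theorem logNorm_const_mul_of_aemeasurable (c : ℝ≥0∞) (hF : AEMeasurable F logMeasure) :
    logNorm q I (fun u => c * F u) = c * logNorm q I F := by
  rcases eq_or_ne q 0 with rfl | hq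
  · simp [logNorm]
  rcases eq_or_ne q ∞ with rfl | hq'
  · simp only [logNorm, eLpNorm_exponent_top, eLpNormEssSup, enorm_eq_self]
    exact ENNReal.essSup_const_mul
  · have hr : 0 < q.toReal := ENNReal.toReal_pos hq hq'
    simp only [logNorm, eLpNorm_eq_lintegral_rpow_enorm_toReal hq hq', enorm_eq_self,
      ENNReal.mul_rpow_of_nonneg _ _ hr.le]
    rw [lintegral_const_mul'' _ (hF.restrict.pow_const _),
      ENNReal.mul_rpow_of_nonneg _ _ (by positivity), ← ENNReal.rpow_mul,
      mul_one_div_cancel hr.ne', ENNReal.rpow_one]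

theorem logNorm_mono_const_mul (hI : MeasurableSet I) {c : ℝ≥0∞} (hc : c ≠ ∞)
    (h : ∀ u ∈ I, 0 < u → F u ≤ c * G u) : logNorm q I F ≤ c * logNorm q I G :=
  (logNorm_mono hI h).trans_eq (logNorm_const_mul hc)

theorem logNorm_add_le (hF : AEMeasurable F logMeasure) (hG : AEMeasurable G logMeasure) :
    logNorm q I (fun u => F u + G u) ≤ ENNReal.LpAddConst q * (logNorm q I F + logNorm q I G) :=
  eLpNorm_add_le' hF.restrict.aestronglyMeasurable hG.restrict.aestronglyMeasurable q

theorem logNorm_indicator (hI : MeasurableSet I) (hIJ : I ⊆ J) :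
    logNorm q J (I.indicator F) = logNorm q I F := by
  rw [logNorm, eLpNorm_indicator_eq_eLpNorm_restrict hI, Measure.restrict_restrict hI,
    inter_eq_left.2 hIJ, logNorm]

theorem logNorm_union_le (hF : AEMeasurable F logMeasure) (hI : MeasurableSet I)
    (hJ : MeasurableSet J) :
    logNorm q (I ∪ J) F ≤ ENNReal.LpAddConst q * (logNorm q I F + logNorm q J F) := by
  rw [← logNorm_indicator (F := F) (q := q) hI (subset_union_left (t := J)),
    ← logNorm_indicator (F := F) (q := q) hJ (subset_union_right (s := I))]
  refine le_trans (logNorm_mono (hI.union hJ) fun u hu _ => ?_)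
    (logNorm_add_le (hF.indicator hI) (hF.indicator hJ))
  rcases hu with hu | hu <;> simp [hu]

theorem logNorm_comp_mul {c : ℝ} (hc : 0 < c) (I : Set ℝ) (F : ℝ → ℝ≥0∞) :
    logNorm q ((fun u => c * u) ⁻¹' I) (fun u => F (c * u)) = logNorm q I F := by
  have hemb : MeasurableEmbedding (fun u : ℝ => c * u) :=
    (Homeomorph.mulLeft₀ c hc.ne').measurableEmbedding
  have h := (measurePreserving_mul_left_logMeasure hc).restrict_preimage_emb hemb I
  rw [logNorm, logNorm, ← h.map_eq, hemb.eLpNorm_map_measure]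
  rfl

theorem logNorm_Ioo_mul {c : ℝ} (hc : 0 < c) (s t : ℝ) (F : ℝ → ℝ≥0∞) :
    logNorm q (Ioo (c * s) (c * t)) F = logNorm q (Ioo s t) (fun u => F (c * u)) := by
  rw [← logNorm_comp_mul hc]
  congr 1
  ext u
  simp only [mem_preimage, mem_Ioo, mul_lt_mul_iff_right₀ hc]

theorem logNorm_Ioi_mul {c : ℝ} (hc : 0 < c) (s : ℝ) (F : ℝ → ℝ≥0∞) :
    logNorm q (Ioi (c * s)) F = logNorm q (Ioi s) (fun u => F (c * u)) := by
  rw [← logNorm_comp_mul hc]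
  congr 1
  ext u
  simp only [mem_preimage, mem_Ioi, mul_lt_mul_iff_right₀ hc]

theorem logNorm_Ioo_two_mul_one (hq : 0 < q) :
    logNorm q (Ioo 1 2) (fun _ => 1) ≠ 0 := by
  have hm : logMeasure (Ioo 1 2) = ENNReal.ofReal (Real.log 2) := by
    simpa using logMeasure_Ioo one_pos two_pos
  have hpos : 0 < ENNReal.ofReal (Real.log 2) := by
    simpa using Real.log_pos one_lt_two
  rw [logNorm, eLpNorm_const _ hq.ne' (by
    rw [Ne, Measure.restrict_eq_zero, hm]; exact hpos.ne')]
  simp [hm, Real.log_pos one_lt_two]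

/-- A quantity dominated by `F` on `(x, 2x)` is dominated by `‖F‖` there. -/
theorem le_logNorm_of_le (hq : 0 < q) :
    ∃ κ : ℝ≥0, ∀ (x : ℝ) (c : ℝ≥0∞) (F : ℝ → ℝ≥0∞), 0 < x →
      (∀ u ∈ Ioo x (2 * x), c ≤ F u) → c ≤ κ * logNorm q (Ioo x (2 * x)) F := by
  have hne := logNorm_Ioo_two_mul_one hq
  -- By dilation the norm of 1 over (x, 2x) does not depend on x, so its inverse over (1, 2) is a
  -- uniform constant.
  refine ⟨(logNorm q (Ioo 1 2) (fun _ => 1))⁻¹.toNNReal, fun x c F hx h => ?_⟩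
  rw [ENNReal.coe_toNNReal (ENNReal.inv_ne_top.2 hne)]
  have h1 : c * logNorm q (Ioo 1 2) (fun _ => 1) ≤ logNorm q (Ioo x (2 * x)) F := by
    have h2 := logNorm_Ioo_mul (q := q) hx 1 2 (fun _ => 1)
    rw [mul_one, mul_comm x 2] at h2
    rw [← h2, ← logNorm_const_mul_of_aemeasurable c aemeasurable_const]
    exact logNorm_mono measurableSet_Ioo fun u hu _ => by simpa using h u hu
  have hlt : logNorm q (Ioo 1 2) (fun _ => (1 : ℝ≥0∞)) ≠ ∞ := by
    have hm : logMeasure (Ioo 1 2) = ENNReal.ofReal (Real.log 2) := by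
      simpa using logMeasure_Ioo one_pos two_pos
    have : IsFiniteMeasure (logMeasure.restrict (Ioo 1 2)) := ⟨by simp [hm]⟩
    exact (memLp_const_enorm (by simp)).2.ne
  calc c = (logNorm q (Ioo 1 2) (fun _ => 1))⁻¹ * (c * logNorm q (Ioo 1 2) (fun _ => 1)) := by
        rw [mul_comm c, ← mul_assoc, ENNReal.inv_mul_cancel hne hlt, one_mul]
    _ ≤ _ := by gcongr

theorem antitone_logNorm_Ioi (q : ℝ≥0∞) (F : ℝ → ℝ≥0∞) :
    Antitone fun t => logNorm q (Ioi t) F :=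
  fun _ _ h => logNorm_mono_set (Ioi_subset_Ioi h)

end logNorm

/-- Powers `u ^ (-δ)` have finite norm on `(1, ∞)`. -/
theorem logNorm_Ioi_one_rpow_ne_top (q : ℝ≥0∞) {δ : ℝ} (hδ : 0 < δ) :
    logNorm q (Ioi 1) (fun u => ENNReal.ofReal (u ^ (-δ))) ≠ ∞ := by
  rcases eq_or_ne q 0 with rfl | hq
  · simp [logNorm]
  rcases eq_or_ne q ∞ with rfl | hq'
  · rw [logNorm, eLpNorm_exponent_top]
    refine ne_top_of_le_ne_top ENNReal.one_ne_top (essSup_le_of_ae_le 1 ?_)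
    filter_upwards [ae_restrict_mem measurableSet_Ioi] with u hu
    simp only [enorm_eq_self]
    exact ENNReal.ofReal_le_one.2 (Real.rpow_le_one_of_one_le_of_nonpos hu.le (by linarith))
  · have hr : 0 < q.toReal := ENNReal.toReal_pos hq hq'
    rw [logNorm, eLpNorm_eq_lintegral_rpow_enorm_toReal hq hq']
    refine ENNReal.rpow_ne_top_of_nonneg (by positivity) ?_
    rw [setLIntegral_logMeasure (Ioi_subset_Ioi zero_le_one) measurableSet_Ioi]
    have hint := (integrableOn_Ioi_rpow_of_lt
      (by nlinarith [mul_pos hδ hr] : -1 - δ * q.toReal < -1) one_pos).lintegral_lt_top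
    refine ne_top_of_le_ne_top hint.ne (setLIntegral_mono' measurableSet_Ioi fun u hu => ?_)
    have hu0 : 0 < u := one_pos.trans hu
    rw [enorm_eq_self, ENNReal.ofReal_rpow_of_pos (by positivity), ← Real.rpow_mul hu0.le,
      ← ENNReal.ofReal_mul (by positivity), ← Real.rpow_neg_one, ← Real.rpow_add hu0]
    refine (ENNReal.ofReal_le_ofReal (le_of_eq ?_))
    congr 1
    ring

/-- Powers `u ^ δ` have finite integral on `(0, 1)` with respect to `du / u`. -/
theorem lintegral_Ioo_rpow_ne_top {δ : ℝ} (hδ : 0 < δ) :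
    ∫⁻ u in Ioo 0 1, ENNReal.ofReal (u ^ δ) ∂logMeasure ≠ ∞ := by
  rw [setLIntegral_logMeasure Ioo_subset_Ioi_self measurableSet_Ioo]
  have hint := ((intervalIntegral.integrableOn_Ioo_rpow_iff (s := δ - 1) one_pos).2
    (by linarith)).lintegral_lt_top
  refine ne_top_of_le_ne_top hint.ne (setLIntegral_mono' measurableSet_Ioo fun u hu => ?_)
  rw [← ENNReal.ofReal_mul (inv_pos.2 hu.1).le, ← Real.rpow_neg_one, ← Real.rpow_add hu.1]
  refine (ENNReal.ofReal_le_ofReal (le_of_eq ?_))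
  congr 1
  ring

/-! ### Functions with power bounds and slowly varying functions -/

/-- `F` changes by at most a constant multiple of `(t / s) ^ N` between `s` and `t ≥ s`. -/
def PowerBound (N : ℝ) (F : ℝ → ℝ≥0∞) : Prop :=
  ∃ C : ℝ≥0, ∀ s t : ℝ, 0 < s → s ≤ t →
    F s ≤ C * ENNReal.ofReal ((t / s) ^ N) * F t ∧ F t ≤ C * ENNReal.ofReal ((t / s) ^ N) * F s

namespace PowerBound

variable {N M : ℝ} {F G : ℝ → ℝ≥0∞}

theorem mul (hF : PowerBound N F) (hG : PowerBound M G) :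
    PowerBound (N + M) (fun u => F u * G u) := by
  obtain ⟨C, hC⟩ := hF
  obtain ⟨D, hD⟩ := hG
  refine ⟨C * D, fun s t hs hst => ?_⟩
  have hts : 0 < t / s := div_pos (hs.trans_le hst) hs
  have e : ENNReal.ofReal ((t / s) ^ (N + M)) =
      ENNReal.ofReal ((t / s) ^ N) * ENNReal.ofReal ((t / s) ^ M) := by
    rw [Real.rpow_add hts, ENNReal.ofReal_mul (by positivity)]
  rw [e, ENNReal.coe_mul]
  constructor
  · calc F s * G s ≤ (C * ENNReal.ofReal ((t / s) ^ N) * F t) *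
          (D * ENNReal.ofReal ((t / s) ^ M) * G t) :=
        mul_le_mul' (hC s t hs hst).1 (hD s t hs hst).1
      _ = _ := by ring
  · calc F t * G t ≤ (C * ENNReal.ofReal ((t / s) ^ N) * F s) *
          (D * ENNReal.ofReal ((t / s) ^ M) * G s) :=
        mul_le_mul' (hC s t hs hst).2 (hD s t hs hst).2
      _ = _ := by ring

theorem rpow (α : ℝ) : PowerBound |α| (fun u => ENNReal.ofReal (u ^ α)) := by
  refine ⟨1, fun s t hs hst => ?_⟩
  have ht : 0 < t := hs.trans_le hst
  have h1 : 1 ≤ t / s := (one_le_div hs).2 hst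
  have hts : 0 < t / s := one_pos.trans_le h1
  rw [ENNReal.coe_one, one_mul, ← ENNReal.ofReal_mul (by positivity),
    ← ENNReal.ofReal_mul (by positivity)]
  have hdiv : t ^ α = (t / s) ^ α * s ^ α := by
    rw [← Real.mul_rpow hts.le hs.le, div_mul_cancel₀ _ hs.ne']
  have hdiv' : s ^ α = (t / s) ^ (-α) * t ^ α := by
    rw [hdiv, ← mul_assoc, ← Real.rpow_add hts]
    simp
  constructor
  · refine ENNReal.ofReal_le_ofReal (hdiv'.trans_le ?_)
    gcongr
    exact neg_le_abs α
  · refine ENNReal.ofReal_le_ofReal (hdiv.trans_le ?_)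
    gcongr
    exact le_abs_self α

/-- Uniform comparison at arguments with bounded ratio. -/
theorem exists_le_of_le_mul (hF : PowerBound N F) (Λ : ℝ) :
    ∃ C : ℝ≥0, ∀ s t : ℝ, 0 < s → 0 < t → s ≤ Λ * t → t ≤ Λ * s → F s ≤ C * F t := by
  obtain ⟨C, hC⟩ := hF
  refine ⟨C * Real.toNNReal (max 1 Λ ^ |N|), fun s t hs ht h1 h2 => ?_⟩
  have key : ∀ x : ℝ, 1 ≤ x → x ≤ Λ →
      ENNReal.ofReal (x ^ N) ≤ (Real.toNNReal (max 1 Λ ^ |N|) : ℝ≥0∞) := by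
    intro x hx1 hx2
    refine ENNReal.ofReal_le_ofReal ?_
    exact (Real.rpow_le_rpow_of_exponent_le hx1 (le_abs_self N)).trans
      (Real.rpow_le_rpow (by linarith) (hx2.trans (le_max_right _ _)) (abs_nonneg N))
  rw [ENNReal.coe_mul]
  rcases le_total s t with hst | hst
  · refine (hC s t hs hst).1.trans ?_
    gcongr
    exact key _ ((one_le_div hs).2 hst) ((div_le_iff₀ hs).2 h2)
  · refine (hC t s ht hst).2.trans ?_
    gcongr
    exact key _ ((one_le_div ht).2 hst) ((div_le_iff₀ ht).2 h1)

/-- A function with a power bound is dominated by its norm over `(x, 2x)`. -/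
theorem exists_le_logNorm (hF : PowerBound N F) {q : ℝ≥0∞} (hq : 0 < q) :
    ∃ C : ℝ≥0, ∀ x : ℝ, 0 < x → F x ≤ C * logNorm q (Ioo x (2 * x)) F ∧
      F (2 * x) ≤ C * logNorm q (Ioo x (2 * x)) F := by
  obtain ⟨C, hC⟩ := hF.exists_le_of_le_mul 2
  obtain ⟨κ, hκ⟩ := le_logNorm_of_le hq
  refine ⟨κ * C, fun x hx => ?_⟩
  rw [ENNReal.coe_mul, mul_assoc, ← logNorm_const_mul ENNReal.coe_ne_top]
  exact ⟨hκ x _ _ hx fun u hu =>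
      hC x u hx (hx.trans hu.1) (by linarith [hu.1]) hu.2.le,
    hκ x _ _ hx fun u hu =>
      hC _ u (by positivity) (hx.trans hu.1) (by linarith [hu.1]) (by linarith [hu.1, hu.2])⟩

end PowerBound

/-- The almost increasing function t^ε b(t) bounds b(s) by b(t), and the almost decreasing t^{-ε}
b(t) bounds b(t) by b(s). All later uses of slow variation other than measurability and positivity
go through this pair of bounds. -/
theorem IsSlowlyVarying.exists_le {b : ℝ → ℝ} (hb : IsSlowlyVarying b) {ε : ℝ} (hε : 0 < ε) :
    ∃ C : ℝ, 0 < C ∧ ∀ s t : ℝ, 0 < s → s ≤ t →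
      b s ≤ C * (t / s) ^ ε * b t ∧ b t ≤ C * (t / s) ^ ε * b s := by
  obtain ⟨g, hg, C, hC, hCg⟩ := hb.increasing ε hε
  obtain ⟨h, hh, D, hD, hDh⟩ := hb.decreasing ε hε
  refine ⟨max (C * C) (D * D), by positivity, fun s t hs hst => ?_⟩
  have ht : 0 < t := hs.trans_le hst
  have hbs := hb.pos s hs
  have hbt := hb.pos t ht
  have hsε : 0 < s ^ ε := by positivity
  have htε : 0 < t ^ ε := by positivity
  rw [Real.div_rpow ht.le hs.le]
  constructor
  · have h1 : s ^ ε * b s ≤ C * C * (t ^ ε * b t) :=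
      calc s ^ ε * b s ≤ C * g s := (hCg s hs).1
        _ ≤ C * g t := by gcongr; exact hg hs ht hst
        _ ≤ C * (C * (t ^ ε * b t)) := by gcongr; exact (hCg t ht).2
        _ = _ := by ring
    calc b s = s ^ ε * b s / s ^ ε := by field_simp
      _ ≤ C * C * (t ^ ε * b t) / s ^ ε := by gcongr
      _ = C * C * (t ^ ε / s ^ ε) * b t := by ring
      _ ≤ _ := by gcongr; exact le_max_left _ _
  · have h1 : t ^ (-ε) * b t ≤ D * D * (s ^ (-ε) * b s) :=
      calc t ^ (-ε) * b t ≤ D * h t := (hDh t ht).1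
        _ ≤ D * h s := by gcongr; exact hh hs ht hst
        _ ≤ D * (D * (s ^ (-ε) * b s)) := by gcongr; exact (hDh s hs).2
        _ = _ := by ring
    rw [Real.rpow_neg ht.le, Real.rpow_neg hs.le] at h1
    calc b t = t ^ ε * ((t ^ ε)⁻¹ * b t) := by field_simp
      _ ≤ t ^ ε * (D * D * ((s ^ ε)⁻¹ * b s)) := by gcongr
      _ = D * D * (t ^ ε / s ^ ε) * b s := by ring
      _ ≤ _ := by gcongr; exact le_max_right _ _

theorem IsSlowlyVarying.powerBound {b : ℝ → ℝ} (hb : IsSlowlyVarying b) {ε : ℝ} (hε : 0 < ε) :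
    PowerBound ε (fun u => ENNReal.ofReal (b u)) := by
  obtain ⟨C, hC, h⟩ := hb.exists_le hε
  refine ⟨C.toNNReal, fun s t hs hst => ?_⟩
  have ht : 0 < t := hs.trans_le hst
  change _ ≤ ENNReal.ofReal C * _ * _ ∧ _ ≤ ENNReal.ofReal C * _ * _
  rw [← ENNReal.ofReal_mul hC.le, ← ENNReal.ofReal_mul (by positivity),
    ← ENNReal.ofReal_mul (by positivity)]
  exact ⟨ENNReal.ofReal_le_ofReal (h s t hs hst).1, ENNReal.ofReal_le_ofReal (h s t hs hst).2⟩

theorem IsSlowlyVarying.aemeasurable {b : ℝ → ℝ} (hb : IsSlowlyVarying b) :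
    AEMeasurable (fun u => ENNReal.ofReal (b u)) logMeasure :=
  (hb.measurable.mono_ac logMeasure_absolutelyContinuous).ennreal_ofReal

/-- A slowly varying function is equivalent to a Borel measurable slowly varying function. -/
theorem IsSlowlyVarying.exists_measurable {b : ℝ → ℝ} (hb : IsSlowlyVarying b) :
    ∃ b' : ℝ → ℝ, IsSlowlyVarying b' ∧ Measurable b' ∧ EquivOnPos b b' := by
  -- A non-decreasing g equivalent to t b(t) is Borel on (0, ∞), so g(t)/t is a Borel representative
  -- of b up to constants.
  obtain ⟨g, hg, C, hC, hCg⟩ := hb.increasing 1 one_pos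
  simp only [Real.rpow_one] at hCg
  have hgpos : ∀ t : ℝ, 0 < t → 0 < g t := fun t ht => by
    have := (hCg t ht).1
    have h2 := mul_pos ht (hb.pos t ht)
    exact pos_of_mul_pos_right (h2.trans_le this) hC.le
  have hmeas : Measurable (fun t => (Ioi (0 : ℝ)).indicator (fun t => t⁻¹ * g t) t) := by
    have h1 : Measurable ((Ioi (0 : ℝ)).indicator g) := by
      have hm : Monotone ((Ioi (0 : ℝ)).indicator g) := by
        intro x y hxy
        by_cases hx : 0 < x
        · have hy : 0 < y := hx.trans_le hxy
          simpa [indicator, hx, hy] using hg hx hy hxy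
        · by_cases hy : 0 < y
          · simpa [indicator, hx, hy] using (hgpos y hy).le
          · simp [indicator, hx, hy]
      exact hm.measurable
    have h2 : (fun t => (Ioi (0 : ℝ)).indicator (fun t => t⁻¹ * g t) t) =
        fun t => t⁻¹ * (Ioi (0 : ℝ)).indicator g t := by
      funext t
      by_cases ht : 0 < t <;> simp [indicator, ht]
    rw [h2]
    exact measurable_inv.mul h1
  set b' : ℝ → ℝ := fun t => (Ioi (0 : ℝ)).indicator (fun t => t⁻¹ * g t) t with hb'
  have hval : ∀ t : ℝ, 0 < t → b' t = t⁻¹ * g t := fun t ht => by simp [hb', indicator, ht]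
  have hequiv : ∀ t : ℝ, 0 < t → b t ≤ C * b' t ∧ b' t ≤ C * b t := fun t ht => by
    rw [hval t ht]
    constructor
    · calc b t = t⁻¹ * (t * b t) := by field_simp
        _ ≤ t⁻¹ * (C * g t) := mul_le_mul_of_nonneg_left (hCg t ht).1 (by positivity)
        _ = _ := by ring
    · calc t⁻¹ * g t ≤ t⁻¹ * (C * (t * b t)) := by gcongr; exact (hCg t ht).2
        _ = _ := by field_simp
  have htransfer : ∀ (ε : ℝ) (h : ℝ → ℝ), EquivOnPos (fun t => t ^ ε * b t) h →
      EquivOnPos (fun t => t ^ ε * b' t) h := by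
    rintro ε h ⟨D, hD, hDh⟩
    refine ⟨C * D, by positivity, fun t ht => ⟨?_, ?_⟩⟩
    · calc t ^ ε * b' t ≤ t ^ ε * (C * b t) := by gcongr; exact (hequiv t ht).2
        _ = C * (t ^ ε * b t) := by ring
        _ ≤ C * (D * h t) := mul_le_mul_of_nonneg_left (hDh t ht).1 hC.le
        _ = _ := by ring
    · calc h t ≤ D * (t ^ ε * b t) := (hDh t ht).2
        _ ≤ D * (t ^ ε * (C * b' t)) := by gcongr; exact (hequiv t ht).1
        _ = _ := by ring
  refine ⟨b', ⟨fun t ht => ?_, hmeas.aemeasurable, fun ε hε => ?_, fun ε hε => ?_⟩, hmeas,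
    C, hC, hequiv⟩
  · rw [hval t ht]
    exact mul_pos (inv_pos.2 ht) (hgpos t ht)
  · obtain ⟨h, hm, he⟩ := hb.increasing ε hε
    exact ⟨h, hm, htransfer ε h he⟩
  · obtain ⟨h, hm, he⟩ := hb.decreasing ε hε
    exact ⟨h, hm, htransfer _ h he⟩

/-- Tails of `u⁻¹ a(u)` for a slowly growing `a`. -/
theorem exists_logNorm_tail_le {a : ℝ → ℝ≥0∞} (ha : PowerBound (1 / 2) a) (q : ℝ≥0∞) :
    ∃ C : ℝ≥0, ∀ t : ℝ, 0 < t →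
      logNorm q (Ioi t) (fun u => ENNReal.ofReal u⁻¹ * a u) ≤ C * (ENNReal.ofReal t⁻¹ * a t) := by
  obtain ⟨C, hC⟩ := ha
  have hfin := logNorm_Ioi_one_rpow_ne_top q (one_half_pos (α := ℝ))
  -- After rescaling to (1, ∞), u⁻¹ beats the growth u^{1/2} of `a` and leaves the power u^{-1/2},
  -- which has finite norm for every q.
  refine ⟨C * (logNorm q (Ioi 1) fun u => ENNReal.ofReal (u ^ (-(1 / 2 : ℝ)))).toNNReal,
    fun t ht => ?_⟩
  rw [ENNReal.coe_mul, ENNReal.coe_toNNReal hfin]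
  have h1 := logNorm_Ioi_mul (q := q) ht 1 (fun u => ENNReal.ofReal u⁻¹ * a u)
  rw [mul_one] at h1
  rw [h1]
  calc logNorm q (Ioi 1) (fun u => ENNReal.ofReal (t * u)⁻¹ * a (t * u))
      ≤ logNorm q (Ioi 1) (fun u => (C * (ENNReal.ofReal t⁻¹ * a t)) *
          ENNReal.ofReal (u ^ (-(1 / 2 : ℝ)))) := by
        refine logNorm_mono measurableSet_Ioi fun u hu hu0 => ?_
        have h2 := (hC t (t * u) ht (le_mul_of_one_le_right ht.le hu.le)).2
        rw [mul_div_cancel_left₀ _ ht.ne'] at h2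
        calc ENNReal.ofReal (t * u)⁻¹ * a (t * u)
            ≤ ENNReal.ofReal (t * u)⁻¹ * (C * ENNReal.ofReal (u ^ (1 / 2 : ℝ)) * a t) := by gcongr
          _ = C * (ENNReal.ofReal t⁻¹ * a t) *
              (ENNReal.ofReal u⁻¹ * ENNReal.ofReal (u ^ (1 / 2 : ℝ))) := by
            rw [mul_inv, ENNReal.ofReal_mul (by positivity)]
            ring
          _ = _ := by
            rw [← ENNReal.ofReal_mul (by positivity), ← Real.rpow_neg_one u, ← Real.rpow_add hu0]
            norm_num
    _ = C * (ENNReal.ofReal t⁻¹ * a t) *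
          logNorm q (Ioi 1) (fun u => ENNReal.ofReal (u ^ (-(1 / 2 : ℝ)))) :=
        logNorm_const_mul_of_aemeasurable _ (by fun_prop)
    _ = _ := by ring

/-! ### The function `χ` -/

/-- `‖b(s) ‖a‖_{q,(s,t)}‖_{r,(0,t)}` with respect to `du / u`. -/
noncomputable def chi (r : ℝ≥0∞) (b : ℝ → ℝ≥0∞) (q : ℝ≥0∞) (a : ℝ → ℝ≥0∞) (t : ℝ) : ℝ≥0∞ :=
  logNorm r (Ioo 0 t) (fun s => b s * logNorm q (Ioo s t) a)

theorem nestedNorm_eq_chi {r q : ℝ≥0∞} (hr : 0 < r) (hq : 0 < q) (b a : ℝ → ℝ) (t : ℝ) :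
    nestedNorm r b q a t =
      chi r (fun u => ENNReal.ofReal (b u)) q (fun u => ENNReal.ofReal (a u)) t := by
  rw [nestedNorm, lqNorm_weight_zero_mul hr Ioo_subset_Ioi_self measurableSet_Ioo, chi]
  refine logNorm_congr measurableSet_Ioo fun s hs hs0 => ?_
  rw [lqNorm_weight_zero hq (fun x hx => hs0.trans hx.1) measurableSet_Ioo]

section chi

variable {r q : ℝ≥0∞} {b a : ℝ → ℝ≥0∞}

theorem monotone_chi : Monotone (chi r b q a) := fun _ _ hxy =>
  (logNorm_mono measurableSet_Ioo fun _ _ _ => mul_le_mul_right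
    (logNorm_mono_set (Ioo_subset_Ioo_right hxy)) _).trans
    (logNorm_mono_set (Ioo_subset_Ioo_right hxy))

theorem exists_logNorm_Ioo_zero_mul_le {N : ℝ} (hb : PowerBound N b) :
    ∃ C : ℝ≥0, ∀ c t : ℝ, 1 ≤ c → 0 < t →
      logNorm r (Ioo 0 (c * t)) b ≤ C * ENNReal.ofReal (c ^ N) * logNorm r (Ioo 0 t) b := by
  obtain ⟨C, hC⟩ := hb
  refine ⟨C, fun c t hc ht => ?_⟩
  have hc0 : 0 < c := one_pos.trans_le hc
  have h := logNorm_Ioo_mul (q := r) hc0 0 t b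
  rw [mul_zero] at h
  rw [h]
  refine logNorm_mono_const_mul measurableSet_Ioo (by finiteness) fun u hu hu0 => ?_
  have h2 := (hC u (c * u) hu0 (le_mul_of_one_le_left hu0.le hc)).2
  rwa [mul_div_cancel_right₀ _ hu0.ne'] at h2

/-- Dilating both variables by c maps the nested intervals for t to those for ct, while `b` and `a`
change by at most c^N and c^M. With small exponents this makes χ grow slower than any prescribed
positive power. -/
theorem exists_chi_mul_le {N M : ℝ} (hb : PowerBound N b) (ha : PowerBound M a) :
    ∃ C : ℝ≥0, ∀ c t : ℝ, 1 ≤ c → 0 < t →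
      chi r b q a (c * t) ≤ C * ENNReal.ofReal (c ^ (N + M)) * chi r b q a t := by
  obtain ⟨C, hC⟩ := hb
  obtain ⟨D, hD⟩ := ha
  refine ⟨C * D, fun c t hc ht => ?_⟩
  have hc0 : 0 < c := one_pos.trans_le hc
  have h := logNorm_Ioo_mul (q := r) hc0 0 t (fun s => b s * logNorm q (Ioo s (c * t)) a)
  rw [mul_zero] at h
  rw [chi, h]
  refine logNorm_mono_const_mul measurableSet_Ioo (by finiteness) fun u hu hu0 => ?_
  have h2 := (hC u (c * u) hu0 (le_mul_of_one_le_left hu0.le hc)).2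
  rw [mul_div_cancel_right₀ _ hu0.ne'] at h2
  have h3 : logNorm q (Ioo (c * u) (c * t)) a ≤
      (D * ENNReal.ofReal (c ^ M)) * logNorm q (Ioo u t) a := by
    rw [logNorm_Ioo_mul hc0]
    refine logNorm_mono_const_mul measurableSet_Ioo (by finiteness) fun v hv hv0 => ?_
    have h4 := (hD v (c * v) hv0 (le_mul_of_one_le_left hv0.le hc)).2
    rwa [mul_div_cancel_right₀ _ hv0.ne'] at h4
  calc b (c * u) * logNorm q (Ioo (c * u) (c * t)) a
      ≤ (C * ENNReal.ofReal (c ^ N) * b u) *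
        ((D * ENNReal.ofReal (c ^ M)) * logNorm q (Ioo u t) a) := mul_le_mul' h2 h3
    _ = _ := by
      rw [Real.rpow_add hc0, ENNReal.ofReal_mul (by positivity), ENNReal.coe_mul]
      ring

theorem exists_le_logNorm_Ioo_zero {N : ℝ} (hr : 0 < r) (hb : PowerBound N b) :
    ∃ C : ℝ≥0, ∀ t : ℝ, 0 < t → b t ≤ C * logNorm r (Ioo 0 t) b := by
  obtain ⟨C, hC⟩ := hb.exists_le_logNorm hr
  refine ⟨C, fun t ht => ?_⟩
  have h := (hC (t / 2) (by positivity)).2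
  rw [mul_div_cancel₀ t two_ne_zero] at h
  exact h.trans (mul_le_mul_right (logNorm_mono_set (Ioo_subset_Ioo_left (by positivity))) _)

/-- For s < t/2 the inner interval (s, t) contains (t/2, t), over which the norm of `a` already
dominates a(t). Restricting s to (0, t/2) costs only the doubling constant of ‖b‖_{r,(0,t)}. This is
the inequality that absorbs the error terms in the Holmstedt-type estimates. -/
theorem exists_mul_logNorm_le_chi {N M : ℝ} (hq : 0 < q) (hb : PowerBound N b)
    (ha : PowerBound M a) (hbm : AEMeasurable b logMeasure) :
    ∃ C : ℝ≥0, ∀ t : ℝ, 0 < t → a t * logNorm r (Ioo 0 t) b ≤ C * chi r b q a t := by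
  obtain ⟨C, hC⟩ := ha.exists_le_logNorm hq
  obtain ⟨D, hD⟩ := exists_logNorm_Ioo_zero_mul_le (r := r) hb
  refine ⟨C * (D * ENNReal.ofReal (2 ^ N)).toNNReal, fun t ht => ?_⟩
  rw [ENNReal.coe_mul, ENNReal.coe_toNNReal (by finiteness)]
  have h1 := (hC (t / 2) (by positivity)).2
  have h2 := hD 2 (t / 2) one_le_two (by positivity)
  rw [mul_div_cancel₀ t two_ne_zero] at h1 h2
  calc a t * logNorm r (Ioo 0 t) b
      ≤ (C * logNorm q (Ioo (t / 2) t) a) *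
        (D * ENNReal.ofReal (2 ^ N) * logNorm r (Ioo 0 (t / 2)) b) := mul_le_mul' h1 h2
    _ = C * (D * ENNReal.ofReal (2 ^ N)) *
        (logNorm q (Ioo (t / 2) t) a * logNorm r (Ioo 0 (t / 2)) b) := by ring
    _ ≤ _ := by
      gcongr
      rw [← logNorm_const_mul_of_aemeasurable _ hbm]
      refine le_trans (logNorm_mono measurableSet_Ioo fun s hs hs0 => ?_)
        (logNorm_mono_set (Ioo_subset_Ioo_right (by linarith : t / 2 ≤ t)))
      rw [mul_comm]
      gcongr
      exact logNorm_mono_set (Ioo_subset_Ioo_left hs.2.le)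

end chi

/-! ### Tail functionals and a Holmstedt-type estimate for functions -/

/-- `‖u⁻¹ a(u) k(u)‖_{q,(t,∞)}` with respect to `du / u`. -/
noncomputable def tailNorm (q : ℝ≥0∞) (a k : ℝ → ℝ≥0∞) (t : ℝ) : ℝ≥0∞ :=
  logNorm q (Ioi t) (fun u => ENNReal.ofReal u⁻¹ * a u * k u)

/-- `‖b(s) ‖u⁻¹ a(u) k(u)‖_{q,(s,∞)}‖_{r,(t,∞)}` with respect to `du / u`. -/
noncomputable def iteratedTailNorm (r : ℝ≥0∞) (b : ℝ → ℝ≥0∞) (q : ℝ≥0∞) (a k : ℝ → ℝ≥0∞)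
    (t : ℝ) : ℝ≥0∞ :=
  logNorm r (Ioi t) (fun s => b s * tailNorm q a k s)

instance : NullSingletonClass logMeasure := by
  rw [logMeasure]; infer_instance

theorem logNorm_Ioc (q : ℝ≥0∞) (s t : ℝ) (F : ℝ → ℝ≥0∞) :
    logNorm q (Ioc s t) F = logNorm q (Ioo s t) F := by
  rw [logNorm, logNorm, restrict_Ioo_eq_restrict_Ioc]

theorem logNorm_Ioi_le {q : ℝ≥0∞} {F : ℝ → ℝ≥0∞} (hF : AEMeasurable F logMeasure) {s t : ℝ}
    (hst : s ≤ t) :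
    logNorm q (Ioi s) F ≤ ENNReal.LpAddConst q * (logNorm q (Ioo s t) F + logNorm q (Ioi t) F) := by
  rw [← Ioc_union_Ioi_eq_Ioi hst, ← logNorm_Ioc]
  exact logNorm_union_le hF measurableSet_Ioc measurableSet_Ioi

section Holmstedt

variable {r q : ℝ≥0∞} {b a : ℝ → ℝ≥0∞}

@[fun_prop]
theorem measurable_tailNorm (q : ℝ≥0∞) (a k : ℝ → ℝ≥0∞) : Measurable (tailNorm q a k) :=
  (antitone_logNorm_Ioi q _).measurable

@[fun_prop]
theorem measurable_iteratedTailNorm (r : ℝ≥0∞) (b : ℝ → ℝ≥0∞) (q : ℝ≥0∞) (a k : ℝ → ℝ≥0∞) :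
    Measurable (iteratedTailNorm r b q a k) :=
  (antitone_logNorm_Ioi r _).measurable

theorem aemeasurable_mul_logNorm_Ioo (hb : AEMeasurable b logMeasure) (t : ℝ) :
    AEMeasurable (fun s => b s * logNorm q (Ioo s t) a) logMeasure :=
  hb.mul (Antitone.measurable fun _ _ h => logNorm_mono_set (Ioo_subset_Ioo_left h)).aemeasurable

/-- The constant M contributes M times the tail of u⁻¹ a(u), which is of the order of its value at
t. In the applications k and k' are K-functionals of two elements differing by one whose
K-functional is at most M. -/
theorem exists_tailNorm_le (ha : PowerBound (1 / 2) a) (ham : AEMeasurable a logMeasure)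
    (q : ℝ≥0∞) (c : ℝ≥0) :
    ∃ C : ℝ≥0, ∀ (k k' : ℝ → ℝ≥0∞) (M : ℝ≥0∞), AEMeasurable k logMeasure →
      (∀ u : ℝ, 0 < u → k' u ≤ c * (k u + M)) → ∀ t : ℝ, 0 < t →
      tailNorm q a k' t ≤ C * (tailNorm q a k t + M * (ENNReal.ofReal t⁻¹ * a t)) := by
  obtain ⟨D, hD⟩ := exists_logNorm_tail_le ha q
  refine ⟨c * (ENNReal.LpAddConst q).toNNReal * (1 + D), fun k k' M hk hkk t ht => ?_⟩
  push_cast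
  rw [ENNReal.coe_toNNReal (ENNReal.LpAddConst_lt_top q).ne]
  calc tailNorm q a k' t
      ≤ c * logNorm q (Ioi t) (fun u => ENNReal.ofReal u⁻¹ * a u * k u +
          M * (ENNReal.ofReal u⁻¹ * a u)) := by
        refine logNorm_mono_const_mul measurableSet_Ioi ENNReal.coe_ne_top fun u _ hu0 => ?_
        calc ENNReal.ofReal u⁻¹ * a u * k' u
            ≤ ENNReal.ofReal u⁻¹ * a u * (c * (k u + M)) := by gcongr; exact hkk u hu0
          _ = _ := by ring
    _ ≤ c * (ENNReal.LpAddConst q * (tailNorm q a k t + logNorm q (Ioi t) (fun u =>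
          M * (ENNReal.ofReal u⁻¹ * a u)))) := by
        gcongr
        exact logNorm_add_le (by fun_prop) (by fun_prop)
    _ ≤ c * (ENNReal.LpAddConst q * (tailNorm q a k t +
          M * (D * (ENNReal.ofReal t⁻¹ * a t)))) := by
        rw [logNorm_const_mul_of_aemeasurable _ (by fun_prop)]
        gcongr
        exact hD t ht
    _ ≤ c * (ENNReal.LpAddConst q * ((1 + D) * (tailNorm q a k t +
          M * (ENNReal.ofReal t⁻¹ * a t)))) := by
        gcongr
        calc tailNorm q a k t + M * (D * (ENNReal.ofReal t⁻¹ * a t))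
            = 1 * tailNorm q a k t + D * (M * (ENNReal.ofReal t⁻¹ * a t)) := by ring
          _ ≤ (1 + D) * tailNorm q a k t + (1 + D) * (M * (ENNReal.ofReal t⁻¹ * a t)) := by
            gcongr
            · exact le_self_add
            · exact le_add_self
          _ = _ := by ring
    _ = _ := by ring

theorem exists_iteratedTailNorm_le (hb : PowerBound (1 / 4) b) (ha : PowerBound (1 / 4) a)
    (ha' : PowerBound (1 / 2) a)
    (hbm : AEMeasurable b logMeasure) (ham : AEMeasurable a logMeasure)
    (r q : ℝ≥0∞) (c : ℝ≥0) :
    ∃ C : ℝ≥0, ∀ (k k' : ℝ → ℝ≥0∞) (M : ℝ≥0∞), AEMeasurable k logMeasure →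
      (∀ u : ℝ, 0 < u → k' u ≤ c * (k u + M)) → ∀ t : ℝ, 0 < t →
      iteratedTailNorm r b q a k' t ≤
        C * (iteratedTailNorm r b q a k t + M * (ENNReal.ofReal t⁻¹ * (b t * a t))) := by
  obtain ⟨c', hc'⟩ := exists_tailNorm_le ha' ham q c
  -- The exponents 1/4 for `b` and `a` add up to 1/2, as the tail estimate for the product requires.
  have hba : PowerBound (1 / 2) (fun u => b u * a u) := by
    have := hb.mul ha
    norm_num at this ⊢
    exact this
  obtain ⟨D, hD⟩ := exists_logNorm_tail_le hba r
  refine ⟨c' * (ENNReal.LpAddConst r).toNNReal * (1 + D), fun k k' M hk hkk t ht => ?_⟩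
  push_cast
  rw [ENNReal.coe_toNNReal (ENNReal.LpAddConst_lt_top r).ne]
  calc iteratedTailNorm r b q a k' t
      ≤ c' * logNorm r (Ioi t) (fun s => b s * tailNorm q a k s +
          M * (ENNReal.ofReal s⁻¹ * (b s * a s))) := by
        refine logNorm_mono_const_mul measurableSet_Ioi ENNReal.coe_ne_top fun u _ hu0 => ?_
        calc b u * tailNorm q a k' u
            ≤ b u * (c' * (tailNorm q a k u + M * (ENNReal.ofReal u⁻¹ * a u))) := by
              gcongr; exact hc' k k' M hk hkk u hu0
          _ = _ := by ring
    _ ≤ c' * (ENNReal.LpAddConst r * (iteratedTailNorm r b q a k t + logNorm r (Ioi t) (fun u =>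
          M * (ENNReal.ofReal u⁻¹ * (b u * a u))))) := by
        gcongr
        exact logNorm_add_le (by fun_prop) (by fun_prop)
    _ ≤ c' * (ENNReal.LpAddConst r * (iteratedTailNorm r b q a k t +
          M * (D * (ENNReal.ofReal t⁻¹ * (b t * a t))))) := by
        rw [logNorm_const_mul_of_aemeasurable _ (by fun_prop)]
        gcongr
        exact hD t ht
    _ ≤ c' * (ENNReal.LpAddConst r * ((1 + D) * (iteratedTailNorm r b q a k t +
          M * (ENNReal.ofReal t⁻¹ * (b t * a t))))) := by
        gcongr
        calc iteratedTailNorm r b q a k t + M * (D * (ENNReal.ofReal t⁻¹ * (b t * a t)))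
            = 1 * iteratedTailNorm r b q a k t +
              D * (M * (ENNReal.ofReal t⁻¹ * (b t * a t))) := by ring
          _ ≤ (1 + D) * iteratedTailNorm r b q a k t +
              (1 + D) * (M * (ENNReal.ofReal t⁻¹ * (b t * a t))) := by
            gcongr
            · exact le_self_add
            · exact le_add_self
          _ = _ := by ring
    _ = _ := by ring

/-- Upper estimate in the Holmstedt-type formula. -/
theorem exists_iteratedTailNorm_zero_le (hr : 0 < r) (hq : 0 < q)
    (hb : PowerBound (1 / 4) b) (ha : PowerBound (1 / 4) a) (ha' : PowerBound (1 / 2) a)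
    (hbm : AEMeasurable b logMeasure) (ham : AEMeasurable a logMeasure) (c : ℝ≥0) :
    ∃ C : ℝ≥0, ∀ (k k' : ℝ → ℝ≥0∞) (M : ℝ≥0∞) (t : ℝ), 0 < t →
      AEMeasurable k logMeasure → AEMeasurable k' logMeasure →
      (∀ u : ℝ, 0 < u → k' u ≤ ENNReal.ofReal (u / t) * M) →
      (∀ u : ℝ, 0 < u → k' u ≤ c * (k u + M)) →
      iteratedTailNorm r b q a k' 0 ≤ C * (ENNReal.ofReal t⁻¹ * chi r b q a t * M +
        logNorm r (Ioo 0 t) b * tailNorm q a k t + iteratedTailNorm r b q a k t) := by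
  obtain ⟨c₁, hc₁⟩ := exists_tailNorm_le ha' ham q c
  obtain ⟨c₂, hc₂⟩ := exists_iteratedTailNorm_le hb ha ha' hbm ham r q c
  obtain ⟨c₃, hc₃⟩ := exists_mul_logNorm_le_chi (r := r) hq hb ha hbm
  obtain ⟨c₄, hc₄⟩ := exists_le_logNorm_Ioo_zero hr hb
  obtain ⟨lq, elq⟩ : ∃ l : ℝ≥0, ENNReal.LpAddConst q = l :=
    ⟨_, (ENNReal.coe_toNNReal (ENNReal.LpAddConst_lt_top q).ne).symm⟩
  obtain ⟨lr, elr⟩ : ∃ l : ℝ≥0, ENNReal.LpAddConst r = l :=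
    ⟨_, (ENNReal.coe_toNNReal (ENNReal.LpAddConst_lt_top r).ne).symm⟩
  refine ⟨lr * (lr * lq * (1 + c₁ * (1 + c₃)) + c₂ * (1 + c₄ * c₃)),
    fun k k' M t ht hk hk' hM hkk => ?_⟩
  obtain ⟨P, hP⟩ : ∃ x, x = ENNReal.ofReal t⁻¹ * chi r b q a t * M := ⟨_, rfl⟩
  obtain ⟨Q, hQ⟩ : ∃ x, x = logNorm r (Ioo 0 t) b * tailNorm q a k t := ⟨_, rfl⟩
  obtain ⟨T, hT⟩ : ∃ x, x = iteratedTailNorm r b q a k t := ⟨_, rfl⟩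
  rw [← hP, ← hQ, ← hT]
  -- The inner tail is cut at t. On (s, t) the bound k'(u) ≤ (u/t) M cancels u⁻¹ and leaves M/t
  -- times the norm of `a`, which is what χ integrates.
  have hnear : ∀ s : ℝ, 0 < s → s ≤ t → tailNorm q a k' s ≤
      lq * (ENNReal.ofReal t⁻¹ * M * logNorm q (Ioo s t) a + tailNorm q a k' t) := by
    intro s hs hst
    rw [← elq]
    refine (logNorm_Ioi_le (by fun_prop) hst).trans ?_
    gcongr
    · rw [← logNorm_const_mul_of_aemeasurable _ ham]
      refine logNorm_mono measurableSet_Ioo fun u hu hu0 => ?_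
      calc ENNReal.ofReal u⁻¹ * a u * k' u
          ≤ ENNReal.ofReal u⁻¹ * a u * (ENNReal.ofReal (u / t) * M) := by
            gcongr; exact hM u hu0
        _ = ENNReal.ofReal u⁻¹ * ENNReal.ofReal (u / t) * M * a u := by ring
        _ = _ := by
          rw [← ENNReal.ofReal_mul (by positivity)]
          congr 3
          field_simp
    · exact le_rfl
  have hfirst : logNorm r (Ioo 0 t) (fun s => b s * tailNorm q a k' s) ≤
      lr * lq * (P + logNorm r (Ioo 0 t) b * tailNorm q a k' t) := by
    have hmeas := aemeasurable_mul_logNorm_Ioo (q := q) (a := a) hbm t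
    calc logNorm r (Ioo 0 t) (fun s => b s * tailNorm q a k' s)
        ≤ lq * logNorm r (Ioo 0 t) (fun s =>
            ENNReal.ofReal t⁻¹ * M * (b s * logNorm q (Ioo s t) a) +
              tailNorm q a k' t * b s) := by
          refine logNorm_mono_const_mul measurableSet_Ioo ENNReal.coe_ne_top fun s hs hs0 => ?_
          calc b s * tailNorm q a k' s ≤ b s * (lq * (ENNReal.ofReal t⁻¹ * M *
                logNorm q (Ioo s t) a + tailNorm q a k' t)) := by
                gcongr; exact hnear s hs0 hs.2.le
            _ = _ := by ring
      _ ≤ lq * (lr * (ENNReal.ofReal t⁻¹ * M * chi r b q a t +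
            tailNorm q a k' t * logNorm r (Ioo 0 t) b)) := by
          gcongr
          refine (logNorm_add_le (hmeas.const_mul _) (hbm.const_mul _)).trans_eq ?_
          rw [logNorm_const_mul_of_aemeasurable _ hmeas,
            logNorm_const_mul_of_aemeasurable _ hbm, elr]
          rfl
      _ = _ := by rw [hP]; ring
  -- Beyond t, k' is replaced by k + M; the error (M/t) a(t) ‖b‖_{r,(0,t)} is absorbed in P by
  -- `exists_mul_logNorm_le_chi`.
  have hQ' : logNorm r (Ioo 0 t) b * tailNorm q a k' t ≤ c₁ * (1 + c₃) * (P + Q + T) := by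
    calc logNorm r (Ioo 0 t) b * tailNorm q a k' t
        ≤ logNorm r (Ioo 0 t) b * (c₁ * (tailNorm q a k t + M * (ENNReal.ofReal t⁻¹ * a t))) := by
          gcongr; exact hc₁ k k' M hk hkk t ht
      _ = c₁ * (Q + M * ENNReal.ofReal t⁻¹ * (a t * logNorm r (Ioo 0 t) b)) := by rw [hQ]; ring
      _ ≤ c₁ * (Q + M * ENNReal.ofReal t⁻¹ * (c₃ * chi r b q a t)) := by
          exact mul_le_mul_right (add_le_add_right (mul_le_mul_right (hc₃ t ht) _) _) _
      _ = c₁ * (1 * Q + c₃ * P) := by rw [hP]; ring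
      _ ≤ c₁ * (1 * (P + Q + T) + c₃ * (P + Q + T)) := by
          gcongr
          · exact le_add_self.trans le_self_add
          · exact le_self_add.trans le_self_add
      _ = _ := by ring
  have hT' : iteratedTailNorm r b q a k' t ≤ c₂ * (1 + c₄ * c₃) * (P + Q + T) := by
    calc iteratedTailNorm r b q a k' t
        ≤ c₂ * (T + M * (ENNReal.ofReal t⁻¹ * (b t * a t))) := hT ▸ hc₂ k k' M hk hkk t ht
      _ ≤ c₂ * (T + M * (ENNReal.ofReal t⁻¹ * (c₄ * (c₃ * chi r b q a t)))) := by
          refine mul_le_mul_right (add_le_add_right (mul_le_mul_right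
            (mul_le_mul_right ?_ _) _) _) _
          calc b t * a t ≤ c₄ * logNorm r (Ioo 0 t) b * a t := mul_le_mul_left (hc₄ t ht) _
            _ = c₄ * (a t * logNorm r (Ioo 0 t) b) := by ring
            _ ≤ _ := mul_le_mul_right (hc₃ t ht) _
      _ = c₂ * (1 * T + c₄ * c₃ * P) := by rw [hP]; ring
      _ ≤ c₂ * (1 * (P + Q + T) + c₄ * c₃ * (P + Q + T)) := by
          gcongr
          · exact le_add_self
          · exact le_self_add.trans le_self_add
      _ = _ := by ring
  calc iteratedTailNorm r b q a k' 0
      ≤ lr * (logNorm r (Ioo 0 t) (fun s => b s * tailNorm q a k' s) +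
          iteratedTailNorm r b q a k' t) := by
        rw [← elr]
        exact logNorm_Ioi_le (by fun_prop) ht.le
    _ ≤ lr * (lr * lq * ((P + Q + T) + c₁ * (1 + c₃) * (P + Q + T)) +
          c₂ * (1 + c₄ * c₃) * (P + Q + T)) := by
        gcongr
        refine hfirst.trans ?_
        gcongr
        exact le_self_add.trans le_self_add
    _ = _ := by push_cast; ring

/-- Lower estimates in the Holmstedt-type formula. -/
theorem exists_le_iteratedTailNorm_zero (hr : 0 < r) (hq : 0 < q)
    (hb : PowerBound (1 / 4) b) (ha : PowerBound (1 / 4) a) (ha' : PowerBound (1 / 2) a)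
    (hbm : AEMeasurable b logMeasure) (ham : AEMeasurable a logMeasure) (c : ℝ≥0) :
    ∃ C : ℝ≥0, ∀ (k k' : ℝ → ℝ≥0∞) (M : ℝ≥0∞) (t : ℝ), 0 < t →
      AEMeasurable k' logMeasure →
      (∀ u : ℝ, 0 < u → u ≤ t → ENNReal.ofReal (u / t) * k' t ≤ k' u) →
      (∀ u : ℝ, 0 < u → k u ≤ c * (k' u + M)) →
      ENNReal.ofReal t⁻¹ * chi r b q a t * k t +
        logNorm r (Ioo 0 t) b * tailNorm q a k t + iteratedTailNorm r b q a k t ≤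
        C * (ENNReal.ofReal t⁻¹ * chi r b q a t * M + iteratedTailNorm r b q a k' 0) := by
  obtain ⟨c₁, hc₁⟩ := exists_tailNorm_le ha' ham q c
  obtain ⟨c₂, hc₂⟩ := exists_iteratedTailNorm_le hb ha ha' hbm ham r q c
  obtain ⟨c₃, hc₃⟩ := exists_mul_logNorm_le_chi (r := r) hq hb ha hbm
  obtain ⟨c₄, hc₄⟩ := exists_le_logNorm_Ioo_zero hr hb
  refine ⟨c + c₁ * (1 + c₃) + c₂ * (1 + c₄ * c₃), fun k k' M t ht hk' hmono hkk => ?_⟩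
  obtain ⟨P, hP⟩ : ∃ x, x = ENNReal.ofReal t⁻¹ * chi r b q a t * M := ⟨_, rfl⟩
  obtain ⟨X, hX⟩ : ∃ x, x = iteratedTailNorm r b q a k' 0 := ⟨_, rfl⟩
  rw [← hP, ← hX]
  have hmeas := aemeasurable_mul_logNorm_Ioo (q := q) (a := a) hbm t
  -- Since k'(t)/t ≤ k'(u)/u for u ≤ t, freezing k'(u)/u at t and restricting to s < u < t turns
  -- part of the full norm into (χ(t)/t) k'(t).
  have h1 : ENNReal.ofReal t⁻¹ * chi r b q a t * k' t ≤ X := by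
    calc ENNReal.ofReal t⁻¹ * chi r b q a t * k' t
        = ENNReal.ofReal t⁻¹ * k' t * chi r b q a t := by ring
      _ = logNorm r (Ioo 0 t) (fun s => ENNReal.ofReal t⁻¹ * k' t *
            (b s * logNorm q (Ioo s t) a)) :=
          (logNorm_const_mul_of_aemeasurable _ hmeas).symm
      _ ≤ logNorm r (Ioo 0 t) (fun s => b s * tailNorm q a k' s) := by
          refine logNorm_mono measurableSet_Ioo fun s hs hs0 => ?_
          rw [mul_left_comm]
          gcongr
          rw [← logNorm_const_mul_of_aemeasurable _ ham]
          refine le_trans (logNorm_mono measurableSet_Ioo fun u hu hu0 => ?_)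
            (logNorm_mono_set Ioo_subset_Ioi_self)
          calc ENNReal.ofReal t⁻¹ * k' t * a u
              = ENNReal.ofReal u⁻¹ * a u * (ENNReal.ofReal (u / t) * k' t) := by
                have : t⁻¹ = u⁻¹ * (u / t) := by field_simp
                rw [this, ENNReal.ofReal_mul (by positivity)]
                ring
            _ ≤ _ := by gcongr; exact hmono u hu0 hu.2.le
      _ ≤ X := hX ▸ logNorm_mono_set Ioo_subset_Ioi_self
  -- For s < t the tail from s dominates the tail from t, which is a constant for the outer norm.
  have h2 : logNorm r (Ioo 0 t) b * tailNorm q a k' t ≤ X := by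
    rw [hX, mul_comm, ← logNorm_const_mul_of_aemeasurable _ hbm]
    refine le_trans (logNorm_mono measurableSet_Ioo fun s hs hs0 => ?_)
      (logNorm_mono_set Ioo_subset_Ioi_self)
    rw [mul_comm]
    gcongr
    exact antitone_logNorm_Ioi q _ hs.2.le
  have h3 : iteratedTailNorm r b q a k' t ≤ X := hX ▸ logNorm_mono_set (Ioi_subset_Ioi ht.le)
  have e1 : ENNReal.ofReal t⁻¹ * chi r b q a t * k t ≤ c * (P + X) := by
    calc ENNReal.ofReal t⁻¹ * chi r b q a t * k t
        ≤ ENNReal.ofReal t⁻¹ * chi r b q a t * (c * (k' t + M)) := by gcongr; exact hkk t ht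
      _ = c * (P + ENNReal.ofReal t⁻¹ * chi r b q a t * k' t) := by rw [hP]; ring
      _ ≤ _ := by gcongr
  have e2 : logNorm r (Ioo 0 t) b * tailNorm q a k t ≤ c₁ * (1 + c₃) * (P + X) := by
    calc logNorm r (Ioo 0 t) b * tailNorm q a k t
        ≤ logNorm r (Ioo 0 t) b * (c₁ * (tailNorm q a k' t + M * (ENNReal.ofReal t⁻¹ * a t))) := by
          gcongr; exact hc₁ k' k M hk' hkk t ht
      _ = c₁ * (logNorm r (Ioo 0 t) b * tailNorm q a k' t +
            M * ENNReal.ofReal t⁻¹ * (a t * logNorm r (Ioo 0 t) b)) := by ring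
      _ ≤ c₁ * (X + M * ENNReal.ofReal t⁻¹ * (c₃ * chi r b q a t)) := by
          exact mul_le_mul_right (add_le_add h2 (mul_le_mul_right (hc₃ t ht) _)) _
      _ = c₁ * (1 * X + c₃ * P) := by rw [hP]; ring
      _ ≤ c₁ * (1 * (P + X) + c₃ * (P + X)) := by
          gcongr
          · exact le_add_self
          · exact le_self_add
      _ = _ := by ring
  have e3 : iteratedTailNorm r b q a k t ≤ c₂ * (1 + c₄ * c₃) * (P + X) := by
    calc iteratedTailNorm r b q a k t
        ≤ c₂ * (iteratedTailNorm r b q a k' t + M * (ENNReal.ofReal t⁻¹ * (b t * a t))) :=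
          hc₂ k' k M hk' hkk t ht
      _ ≤ c₂ * (X + M * (ENNReal.ofReal t⁻¹ * (c₄ * (c₃ * chi r b q a t)))) := by
          refine mul_le_mul_right (add_le_add h3 (mul_le_mul_right
            (mul_le_mul_right ?_ _) _)) _
          calc b t * a t ≤ c₄ * logNorm r (Ioo 0 t) b * a t := mul_le_mul_left (hc₄ t ht) _
            _ = c₄ * (a t * logNorm r (Ioo 0 t) b) := by ring
            _ ≤ _ := mul_le_mul_right (hc₃ t ht) _
      _ = c₂ * (1 * X + c₄ * c₃ * P) := by rw [hP]; ring
      _ ≤ c₂ * (1 * (P + X) + c₄ * c₃ * (P + X)) := by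
          gcongr
          · exact le_add_self
          · exact le_self_add
      _ = _ := by ring
  calc _ ≤ c * (P + X) + c₁ * (1 + c₃) * (P + X) + c₂ * (1 + c₄ * c₃) * (P + X) :=
        add_le_add (add_le_add e1 e2) e3
    _ = _ := by push_cast; ring

end Holmstedt

/-! ### Schur-type bounds, a Hardy inequality and a change of variables -/

/-- The L₁ case of Schur's test, by Tonelli. It is applied to r-th powers, so neither Hölder nor
Minkowski is needed and r < 1 is no obstacle. -/
theorem lintegral_lintegral_mul_le {K : ℝ → ℝ → ℝ≥0∞} (hK : Measurable (Function.uncurry K))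
    {h : ℝ → ℝ≥0∞} (hh : AEMeasurable h logMeasure) {S : ℝ≥0∞}
    (hS : ∀ u : ℝ, 0 < u → ∫⁻ t, K t u ∂logMeasure ≤ S) :
    ∫⁻ t, ∫⁻ u, K t u * h u ∂logMeasure ∂logMeasure ≤ S * ∫⁻ u, h u ∂logMeasure := by
  rw [lintegral_lintegral_swap (hK.aemeasurable.mul hh.comp_snd), ← lintegral_const_mul'' _ hh]
  refine lintegral_mono_ae ?_
  have hpos := ae_pos_logMeasure univ
  rw [Measure.restrict_univ] at hpos
  filter_upwards [hpos] with u hu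
  rw [lintegral_mul_const _ (by fun_prop)]
  exact mul_le_mul_left (hS u hu) _

theorem logNorm_Ioi_zero_eq {r : ℝ≥0∞} (hr : r ≠ 0) (hr' : r ≠ ∞) (F : ℝ → ℝ≥0∞) :
    logNorm r (Ioi 0) F = (∫⁻ u, F u ^ r.toReal ∂logMeasure) ^ (1 / r.toReal) := by
  rw [logNorm, logMeasure_restrict_Ioi_zero, eLpNorm_eq_lintegral_rpow_enorm_toReal hr hr']
  simp

theorem logNorm_le_of_lintegral_le {r : ℝ≥0∞} (hr : r ≠ 0) (hr' : r ≠ ∞) {F G : ℝ → ℝ≥0∞}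
    {A : ℝ≥0∞} (h : ∫⁻ u, F u ^ r.toReal ∂logMeasure ≤ A * ∫⁻ u, G u ^ r.toReal ∂logMeasure) :
    logNorm r (Ioi 0) F ≤ A ^ (1 / r.toReal) * logNorm r (Ioi 0) G := by
  rw [logNorm_Ioi_zero_eq hr hr', logNorm_Ioi_zero_eq hr hr',
    ← ENNReal.mul_rpow_of_nonneg _ _ (by positivity)]
  gcongr

theorem logNorm_rpow_eq {r : ℝ≥0∞} (hr : r ≠ 0) (hr' : r ≠ ∞) (I : Set ℝ) (F : ℝ → ℝ≥0∞) :
    logNorm r I F ^ r.toReal = ∫⁻ u in I, F u ^ r.toReal ∂logMeasure := by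
  have hp := ENNReal.toReal_pos hr hr'
  rw [logNorm, eLpNorm_eq_lintegral_rpow_enorm_toReal hr hr', ← ENNReal.rpow_mul,
    one_div_mul_cancel hp.ne', ENNReal.rpow_one]
  simp

theorem logNorm_top_le {I : Set ℝ} (hI : MeasurableSet I) {F : ℝ → ℝ≥0∞} {A : ℝ≥0∞}
    (h : ∀ u ∈ I, 0 < u → F u ≤ A) : logNorm ∞ I F ≤ A := by
  rw [logNorm, eLpNorm_exponent_top]
  refine essSup_le_of_ae_le _ ?_
  filter_upwards [ae_restrict_mem hI, ae_pos_logMeasure I] with u hu hu0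
  simpa using h u hu hu0

/-- Comparison of tails in different `L_q`. -/
theorem exists_logNorm_Ioi_le_weighted {r : ℝ≥0∞} (hr : 0 < r) (q : ℝ≥0∞) {δ : ℝ} (hδ : 0 < δ)
    (D : ℝ≥0) :
    ∃ C : ℝ≥0, ∀ G : ℝ → ℝ≥0∞, (∀ u v : ℝ, 0 < u → v ∈ Ioo u (2 * u) → G u ≤ D * G v) →
      ∀ t : ℝ, 0 < t → logNorm q (Ioi t) G ≤
        C * logNorm r (Ioi t) (fun u => ENNReal.ofReal ((u / t) ^ δ) * G u) := by
  obtain ⟨κ, hκ⟩ := le_logNorm_of_le hr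
  have hfin := logNorm_Ioi_one_rpow_ne_top q hδ
  refine ⟨κ * D * (logNorm q (Ioi 1) fun u => ENNReal.ofReal (u ^ (-δ))).toNNReal,
    fun G hG t ht => ?_⟩
  set W := logNorm r (Ioi t) (fun u => ENNReal.ofReal ((u / t) ^ δ) * G u) with hW
  -- G(u) is bounded by its L_r norm over (u, 2u), where the weight is at least (u/t)^δ. The
  -- resulting pointwise decay has finite L_q norm for every q.
  have hpt : ∀ u ∈ Ioi t, 0 < u → G u ≤ κ * D * W * ENNReal.ofReal ((u / t) ^ (-δ)) := by
    intro u hu hu0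
    have h1 : G u ≤ κ * logNorm r (Ioo u (2 * u)) (fun v => D * G v) :=
      hκ u _ _ hu0 fun v hv => hG u v hu0 hv
    rw [logNorm_const_mul ENNReal.coe_ne_top] at h1
    have h2 : logNorm r (Ioo u (2 * u)) G ≤ ENNReal.ofReal ((u / t) ^ (-δ)) * W := by
      refine (logNorm_mono_const_mul measurableSet_Ioo ENNReal.ofReal_ne_top
        fun v hv hv0 => ?_).trans
        (mul_le_mul_right (logNorm_mono_set fun v hv => (lt_trans hu hv.1 : t < v)) _)
      rw [← mul_assoc, ← ENNReal.ofReal_mul (by positivity)]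
      refine le_mul_of_one_le_left' (ENNReal.one_le_ofReal.2 ?_)
      rw [Real.rpow_neg (by positivity), inv_mul_eq_div, one_le_div (by positivity)]
      gcongr
      exact hv.1.le
    calc G u ≤ κ * (D * logNorm r (Ioo u (2 * u)) G) := h1
      _ ≤ κ * (D * (ENNReal.ofReal ((u / t) ^ (-δ)) * W)) := by gcongr
      _ = _ := by ring
  have hscale : logNorm q (Ioi t) (fun u => ENNReal.ofReal ((u / t) ^ (-δ))) =
      logNorm q (Ioi 1) fun u => ENNReal.ofReal (u ^ (-δ)) := by
    have h := logNorm_Ioi_mul (q := q) ht 1 (fun u => ENNReal.ofReal ((u / t) ^ (-δ)))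
    rw [mul_one] at h
    simpa [mul_div_cancel_left₀ _ ht.ne'] using h
  refine (logNorm_mono measurableSet_Ioi hpt).trans ?_
  rw [logNorm_const_mul_of_aemeasurable _ (by fun_prop), hscale]
  push_cast
  rw [ENNReal.coe_toNNReal hfin]
  exact le_of_eq (by ring)

/-- Weighted Hardy inequality with equal exponents. -/
theorem exists_hardy_same_exponent {r : ℝ≥0∞} (hr : 0 < r) {δ : ℝ} (hδ : 0 < δ) (c : ℝ≥0) :
    ∃ C : ℝ≥0, ∀ Φ G : ℝ → ℝ≥0∞, AEMeasurable Φ logMeasure → AEMeasurable G logMeasure →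
      (∀ s t : ℝ, 0 < s → s ≤ t → Φ s ≤ c * ENNReal.ofReal ((s / t) ^ (2 * δ)) * Φ t) →
      logNorm r (Ioi 0) (fun t => Φ t *
        logNorm r (Ioi t) (fun u => ENNReal.ofReal ((u / t) ^ δ) * G u)) ≤
        C * logNorm r (Ioi 0) (fun u => Φ u * G u) := by
  -- Half of the growth exponent 2δ of Φ pays for the weight (u/t)^δ; the other half leaves the
  -- kernel (t/u)^δ, integrable in t over (0, u).
  have hpt : ∀ Φ G : ℝ → ℝ≥0∞,
      (∀ s t : ℝ, 0 < s → s ≤ t → Φ s ≤ c * ENNReal.ofReal ((s / t) ^ (2 * δ)) * Φ t) →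
      ∀ t u : ℝ, 0 < t → t < u → Φ t * (ENNReal.ofReal ((u / t) ^ δ) * G u) ≤
        c * (ENNReal.ofReal ((t / u) ^ δ) * (Φ u * G u)) := by
    intro Φ G hΦ t u ht htu
    have hu : 0 < u := ht.trans htu
    have e : ENNReal.ofReal ((t / u) ^ (2 * δ)) * ENNReal.ofReal ((u / t) ^ δ) =
        ENNReal.ofReal ((t / u) ^ δ) := by
      rw [← ENNReal.ofReal_mul (by positivity), ← inv_div t u, Real.inv_rpow (by positivity),
        ← Real.rpow_neg (by positivity), ← Real.rpow_add (by positivity)]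
      congr 2
      ring
    calc Φ t * (ENNReal.ofReal ((u / t) ^ δ) * G u)
        ≤ (c * ENNReal.ofReal ((t / u) ^ (2 * δ)) * Φ u) *
          (ENNReal.ofReal ((u / t) ^ δ) * G u) := mul_le_mul_left (hΦ t u ht htu.le) _
      _ = c * ((ENNReal.ofReal ((t / u) ^ (2 * δ)) * ENNReal.ofReal ((u / t) ^ δ)) *
          (Φ u * G u)) := by ring
      _ = _ := by rw [e]
  rcases eq_or_ne r ∞ with rfl | hr'
  · refine ⟨c, fun Φ G _ hG hΦ => logNorm_top_le measurableSet_Ioi fun t ht _ => ?_⟩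
    rw [← logNorm_const_mul_of_aemeasurable _ (by fun_prop)]
    refine (logNorm_mono_const_mul measurableSet_Ioi ENNReal.coe_ne_top fun u hu hu0 => ?_).trans
      (mul_le_mul_right (logNorm_mono_set (Ioi_subset_Ioi (le_of_lt ht))) _)
    refine (hpt Φ G hΦ t u ht hu).trans (mul_le_mul_right ?_ _)
    refine mul_le_of_le_one_left' (ENNReal.ofReal_le_one.2 ?_)
    have ht0 : 0 < t := ht
    exact Real.rpow_le_one (by positivity) ((div_le_one hu0).2 (le_of_lt hu)) hδ.le
  · set p := r.toReal with hp_def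
    have hp : 0 < p := ENNReal.toReal_pos hr.ne' hr'
    have hfin := lintegral_Ioo_rpow_ne_top (mul_pos hδ hp)
    set S := ∫⁻ u in Ioo 0 1, ENNReal.ofReal (u ^ (δ * p)) ∂logMeasure with hS
    have hC : ((c : ℝ≥0∞) ^ p * S) ^ (1 / p) ≠ ∞ :=
      ENNReal.rpow_ne_top_of_nonneg (by positivity)
        (ENNReal.mul_ne_top (ENNReal.rpow_ne_top_of_nonneg hp.le ENNReal.coe_ne_top) hfin)
    refine ⟨(((c : ℝ≥0∞) ^ p * S) ^ (1 / p)).toNNReal, fun Φ G hΦm hG hΦ => ?_⟩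
    rw [ENNReal.coe_toNNReal hC]
    refine logNorm_le_of_lintegral_le hr.ne' hr' ?_
    rw [← hp_def]
    set K : ℝ → ℝ → ℝ≥0∞ := fun t u =>
      {z : ℝ × ℝ | 0 < z.1 ∧ z.1 < z.2}.indicator
        (fun z => ENNReal.ofReal ((z.1 / z.2) ^ (δ * p))) (t, u) with hK
    have hKm : Measurable (Function.uncurry K) := by
      refine Measurable.indicator (by fun_prop) ?_
      exact (measurableSet_lt measurable_const measurable_fst).inter
        (measurableSet_lt measurable_fst measurable_snd)
    have hKS : ∀ u : ℝ, 0 < u → ∫⁻ t, K t u ∂logMeasure ≤ S := by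
      intro u hu
      have e1 : (fun t => K t u) =
          (Ioo 0 u).indicator (fun t => ENNReal.ofReal ((t / u) ^ (δ * p))) := by
        funext t
        simp [hK, indicator]
      rw [e1, lintegral_indicator measurableSet_Ioo]
      -- The kernel depends only on t/u, so by dilation its integral in t does not depend on u.
      have h2 := logNorm_Ioo_mul (q := 1) hu 0 1 (fun t => ENNReal.ofReal ((t / u) ^ (δ * p)))
      simp only [mul_zero, mul_one, logNorm, eLpNorm_one_eq_lintegral_enorm, enorm_eq_self,
        mul_div_cancel_left₀ _ hu.ne'] at h2
      exact h2.le
    calc ∫⁻ t, (Φ t * logNorm r (Ioi t) fun u => ENNReal.ofReal ((u / t) ^ δ) * G u) ^ p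
          ∂logMeasure
        ≤ ∫⁻ t, c ^ p * ∫⁻ u, K t u * (Φ u * G u) ^ p ∂logMeasure ∂logMeasure := by
          refine lintegral_mono_ae ?_
          have hpos := ae_pos_logMeasure univ
          rw [Measure.restrict_univ] at hpos
          filter_upwards [hpos] with t ht
          rw [← logNorm_const_mul_of_aemeasurable _ (by fun_prop), logNorm_rpow_eq hr.ne' hr',
            ← lintegral_const_mul' _ _ (ENNReal.rpow_ne_top_of_nonneg hp.le ENNReal.coe_ne_top),
            ← lintegral_indicator measurableSet_Ioi]
          refine lintegral_mono fun u => ?_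
          by_cases hu : t < u
          · have hu0 : 0 < u := ht.trans hu
            simp only [hK, indicator, mem_Ioi, mem_ofPred_eq, ht, hu, and_self, if_true]
            refine (ENNReal.rpow_le_rpow (hpt Φ G hΦ t u ht hu) hp.le).trans_eq ?_
            rw [ENNReal.mul_rpow_of_nonneg _ _ hp.le, ENNReal.mul_rpow_of_nonneg _ _ hp.le,
              ENNReal.ofReal_rpow_of_pos (by positivity), ← Real.rpow_mul (by positivity)]
          · simp [indicator, hu]
      _ = c ^ p * ∫⁻ t, ∫⁻ u, K t u * (Φ u * G u) ^ p ∂logMeasure ∂logMeasure :=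
          lintegral_const_mul' _ _ (ENNReal.rpow_ne_top_of_nonneg hp.le ENNReal.coe_ne_top)
      _ ≤ c ^ p * (S * ∫⁻ u, (Φ u * G u) ^ p ∂logMeasure) := by
          gcongr
          exact lintegral_lintegral_mul_le hKm (by fun_prop) hKS
      _ = _ := by ring

/-- Hardy's inequality for tails of functions that are essentially increasing on dyadic
intervals. -/
theorem exists_hardy {r : ℝ≥0∞} (hr : 0 < r) (q : ℝ≥0∞) {β : ℝ} (hβ : 0 < β) (c D : ℝ≥0) :
    ∃ C : ℝ≥0, ∀ Φ G : ℝ → ℝ≥0∞, AEMeasurable Φ logMeasure → AEMeasurable G logMeasure →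
      (∀ s t : ℝ, 0 < s → s ≤ t → Φ s ≤ c * ENNReal.ofReal ((s / t) ^ β) * Φ t) →
      (∀ u v : ℝ, 0 < u → v ∈ Ioo u (2 * u) → G u ≤ D * G v) →
      logNorm r (Ioi 0) (fun t => Φ t * logNorm q (Ioi t) G) ≤
        C * logNorm r (Ioi 0) (fun u => Φ u * G u) := by
  -- Passing from L_q to L_r introduces the weight (u/t)^{β/2}, which the Hardy inequality with δ =
  -- β/2 tolerates.
  obtain ⟨C₁, h₁⟩ := exists_logNorm_Ioi_le_weighted hr q (half_pos hβ) D
  obtain ⟨C₂, h₂⟩ := exists_hardy_same_exponent hr (half_pos hβ) c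
  refine ⟨C₁ * C₂, fun Φ G hΦm hGm hΦ hG => ?_⟩
  rw [ENNReal.coe_mul, mul_assoc]
  refine (logNorm_mono_const_mul measurableSet_Ioi ENNReal.coe_ne_top fun t ht _ => ?_).trans
    (mul_le_mul_right (h₂ Φ G hΦm hGm ?_) _)
  · rw [mul_left_comm]
    exact mul_le_mul_right (h₁ G hG t ht) _
  · rwa [mul_div_cancel₀ _ (two_ne_zero)]

/-! ### Change of variables along a function that need be neither continuous nor monotone. -/

section ChangeOfVariables

variable {ρ : ℝ → ℝ} {R : ℝ}

/-- `ρ` is positive on `(0, ∞)` and grows there at least like `t ^ (1/2)` and at most like `t`. -/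
structure IsRegularVariable (ρ : ℝ → ℝ) (R : ℝ) : Prop where
  measurable : Measurable ρ
  one_le : 1 ≤ R
  pos : ∀ t : ℝ, 0 < t → 0 < ρ t
  le_mul : ∀ s t : ℝ, 0 < s → s ≤ t → ρ t ≤ t / s * ρ s
  mul_le : ∀ s t : ℝ, 0 < s → s ≤ t → (t / s) ^ (1 / 2 : ℝ) * ρ s ≤ R * ρ t

namespace IsRegularVariable

/-- Growth at least like t^{1/2} means that comparable values come from comparable arguments;
undoing the square root accounts for the square. This replaces an inverse of ρ. -/
theorem le_mul_of_mul_le (h : IsRegularVariable ρ R) {s t c : ℝ} (hs : 0 < s) (hst : s ≤ t)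
    (hc : ρ t ≤ c * ρ s) : t ≤ (R * c) ^ 2 * s := by
  have hρ := h.pos s hs
  have ht : 0 < t := hs.trans_le hst
  have h1 : (t / s) ^ (1 / 2 : ℝ) * ρ s ≤ R * c * ρ s := by
    have := h.mul_le s t hs hst
    have := h.one_le
    nlinarith
  have h2 : (t / s) ^ (1 / 2 : ℝ) ≤ R * c := le_of_mul_le_mul_right h1 hρ
  have h3 : t / s ≤ (R * c) ^ 2 := by
    calc t / s = ((t / s) ^ (1 / 2 : ℝ)) ^ 2 := by
          rw [← Real.rpow_natCast, ← Real.rpow_mul (by positivity)]; norm_num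
      _ ≤ _ := by gcongr
  rwa [div_le_iff₀ hs] at h3

/-- Without continuity there may be no preimage of v. Instead t is taken in the set {ρ ≤ v} above
half of its supremum: then 2t lies outside the set, so v < ρ(2t) ≤ 2ρ(t). -/
theorem exists_near (h : IsRegularVariable ρ R) {v : ℝ} (hv : 0 < v) :
    ∃ t : ℝ, 0 < t ∧ ρ t ≤ v ∧ v < 2 * ρ t := by
  have hR := h.one_le
  have h1 := h.pos 1 one_pos
  set S : Set ℝ := {t | 0 < t ∧ ρ t ≤ v} with hS
  have hne : S.Nonempty := by
    -- Chosen so that x^{1/2} R ρ(1) ≤ v, the left side being an upper bound for ρ(x).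
    set x := min 1 ((v / (R * ρ 1)) ^ 2) with hx
    have hx0 : 0 < x := by positivity
    refine ⟨x, hx0, ?_⟩
    have h2 := h.mul_le x 1 hx0 (min_le_left _ _)
    have h3 : x ^ (1 / 2 : ℝ) ≤ v / (R * ρ 1) := by
      calc x ^ (1 / 2 : ℝ) ≤ ((v / (R * ρ 1)) ^ 2) ^ (1 / 2 : ℝ) :=
            Real.rpow_le_rpow hx0.le (min_le_right _ _) (by norm_num)
        _ = v / (R * ρ 1) := by
          rw [← Real.rpow_natCast, ← Real.rpow_mul (by positivity)]; norm_num
    rw [Real.div_rpow zero_le_one hx0.le, Real.one_rpow] at h2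
    have hxp : 0 < x ^ (1 / 2 : ℝ) := by positivity
    have hρx := h.pos x hx0
    calc ρ x = x ^ (1 / 2 : ℝ) * (1 / x ^ (1 / 2 : ℝ) * ρ x) := by field_simp
      _ ≤ v / (R * ρ 1) * (R * ρ 1) := by gcongr
      _ = v := by field_simp
  have hbdd : BddAbove S := by
    refine ⟨max 1 ((R * (v / ρ 1)) ^ 2), fun t ht => ?_⟩
    rcases le_total t 1 with ht1 | ht1
    · exact ht1.trans (le_max_left _ _)
    · refine le_trans ?_ (le_max_right _ _)
      have h2 := h.le_mul_of_mul_le (c := v / ρ 1) one_pos ht1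
        (by rw [div_mul_cancel₀ _ h1.ne']; exact ht.2)
      simpa using h2
  have hpos : 0 < sSup S := by
    obtain ⟨x, hx⟩ := hne
    exact hx.1.trans_le (le_csSup hbdd hx)
  obtain ⟨t, htS, ht⟩ := exists_lt_of_lt_csSup hne (half_lt_self hpos)
  refine ⟨t, htS.1, htS.2, ?_⟩
  by_contra hcon
  have h2 := h.le_mul t (2 * t) htS.1 (by linarith [htS.1])
  rw [mul_div_cancel_right₀ _ htS.1.ne'] at h2
  have h3 : 2 * t ∈ S := ⟨by linarith [htS.1], h2.trans (not_lt.1 hcon)⟩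
  linarith [le_csSup hbdd h3]

/-- Around a preimage of `v` the function `ρ` is comparable with `v`. -/
theorem exists_Ioo_near (h : IsRegularVariable ρ R) {v : ℝ} (hv : 0 < v) :
    ∃ τ : ℝ, 0 < τ ∧ ∀ t ∈ Ioo τ (2 * τ), v < 4 * R * ρ t ∧ ρ t < 4 * R * v := by
  obtain ⟨τ, hτ, h1, h2⟩ := h.exists_near hv
  refine ⟨τ, hτ, fun t ht => ?_⟩
  have hR := h.one_le
  have ht0 : 0 < t := hτ.trans ht.1
  have hρ := h.pos τ hτ
  have hρt := h.pos t ht0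
  have h3 := h.le_mul τ t hτ ht.1.le
  have h4 := h.mul_le τ t hτ ht.1.le
  have h5 : t / τ ≤ 2 := (div_le_iff₀ hτ).2 ht.2.le
  have h6 : 1 ≤ (t / τ) ^ (1 / 2 : ℝ) :=
    Real.one_le_rpow ((one_le_div hτ).2 ht.1.le) (by norm_num)
  constructor
  · nlinarith [mul_pos (one_pos.trans_le hR) hρt]
  · have h7 : ρ t ≤ 2 * ρ τ := h3.trans (by gcongr)
    nlinarith

/-- Two points of the set have ρ-values within a factor 2 of each other, hence bounded ratio, and
the set lies in an interval of fixed logarithmic length around any of its points. -/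
theorem logMeasure_preimage_le (h : IsRegularVariable ρ R) (v : ℝ) :
    logMeasure {t | 0 < t ∧ ρ t < v ∧ v < 2 * ρ t} ≤
      ENNReal.ofReal (2 * Real.log (1 + (R * 2) ^ 2)) := by
  rcases eq_empty_or_nonempty {t | 0 < t ∧ ρ t < v ∧ v < 2 * ρ t} with he | ⟨t₀, ht₀, h1, h2⟩
  · simp [he]
  have hR := h.one_le
  -- The summand 1 makes the ratio bounds strict, as needed for an open interval.
  set Q := 1 + (R * 2) ^ 2 with hQ
  have hQ0 : 0 < Q := by positivity
  have hsub : {t | 0 < t ∧ ρ t < v ∧ v < 2 * ρ t} ⊆ Ioo (t₀ / Q) (Q * t₀) := by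
    rintro t ⟨ht, h3, h4⟩
    have key : ∀ s t : ℝ, 0 < s → s ≤ t → ρ t < v → v < 2 * ρ s → t < Q * s := by
      intro s t hs hst ha hb
      have := h.le_mul_of_mul_le hs hst (ha.trans hb).le
      nlinarith
    rcases le_total t t₀ with hle | hle
    · refine ⟨?_, by nlinarith [mul_pos ht₀ (by positivity : 0 < (R * 2) ^ 2)]⟩
      rw [div_lt_iff₀ hQ0, mul_comm]
      exact key t t₀ ht hle h1 h4
    · refine ⟨?_, key t₀ t ht₀ hle h3 h2⟩
      rw [div_lt_iff₀ hQ0]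
      nlinarith [mul_pos ht (by positivity : 0 < (R * 2) ^ 2)]
  refine (measure_mono hsub).trans ?_
  rw [logMeasure_Ioo (by positivity) (by positivity), Real.log_mul hQ0.ne' ht₀.ne',
    Real.log_div ht₀.ne' hQ0.ne']
  exact ENNReal.ofReal_le_ofReal (by linarith)

/-- F(ρ(t))^p is replaced by a multiple of the integral of F^p over (ρ(t), 2ρ(t)). After exchanging
the integrals, what remains for fixed v is the measure of {t : ρ(t) < v < 2ρ(t)}, bounded by
`logMeasure_preimage_le`. -/
theorem exists_logNorm_comp_le (h : IsRegularVariable ρ R) {r : ℝ≥0∞} (hr : 0 < r) (D : ℝ≥0) :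
    ∃ C : ℝ≥0, ∀ F : ℝ → ℝ≥0∞, Measurable F →
      (∀ v w : ℝ, 0 < v → w ∈ Ioo v (2 * v) → F v ≤ D * F w) →
      logNorm r (Ioi 0) (fun t => F (ρ t)) ≤ C * logNorm r (Ioi 0) F := by
  rcases eq_or_ne r ∞ with rfl | hr'
  · obtain ⟨κ, hκ⟩ := le_logNorm_of_le ENNReal.zero_lt_top
    refine ⟨κ * D, fun F _ hF => logNorm_top_le measurableSet_Ioi fun t ht _ => ?_⟩
    have hρ := h.pos t ht
    have h1 := hκ (ρ t) (F (ρ t)) (fun w => D * F w) hρ fun w hw => hF _ w hρ hw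
    rw [logNorm_const_mul ENNReal.coe_ne_top] at h1
    rw [ENNReal.coe_mul, mul_assoc]
    exact h1.trans (mul_le_mul_right (mul_le_mul_right
      (logNorm_mono_set fun x hx => (hρ.trans hx.1 : 0 < x)) _) _)
  · obtain ⟨κ, hκ⟩ := le_logNorm_of_le (q := 1) one_pos
    set p := r.toReal with hp_def
    have hp : 0 < p := ENNReal.toReal_pos hr.ne' hr'
    set S := ENNReal.ofReal (2 * Real.log (1 + (R * 2) ^ 2)) with hS
    have hDp : (D : ℝ≥0∞) ^ p ≠ ∞ := ENNReal.rpow_ne_top_of_nonneg hp.le ENNReal.coe_ne_top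
    have hC : (κ * (D : ℝ≥0∞) ^ p * S) ^ (1 / p) ≠ ∞ :=
      ENNReal.rpow_ne_top_of_nonneg (by positivity) (by finiteness)
    refine ⟨((κ * (D : ℝ≥0∞) ^ p * S) ^ (1 / p)).toNNReal, fun F hFm hF => ?_⟩
    rw [ENNReal.coe_toNNReal hC]
    refine logNorm_le_of_lintegral_le hr.ne' hr' ?_
    rw [← hp_def]
    set K : ℝ → ℝ → ℝ≥0∞ := fun t v =>
      {z : ℝ × ℝ | 0 < z.1 ∧ ρ z.1 < z.2 ∧ z.2 < 2 * ρ z.1}.indicator (fun _ => 1) (t, v) with hK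
    have hρm := h.measurable
    have hKm : Measurable (Function.uncurry K) := by
      refine Measurable.indicator (by fun_prop) ?_
      exact (measurableSet_lt measurable_const measurable_fst).inter
        ((measurableSet_lt (by fun_prop) measurable_snd).inter
        (measurableSet_lt measurable_snd (by fun_prop)))
    have hKS : ∀ v : ℝ, 0 < v → ∫⁻ t, K t v ∂logMeasure ≤ S := by
      intro v _
      have e1 : (fun t => K t v) =
          {t | 0 < t ∧ ρ t < v ∧ v < 2 * ρ t}.indicator (fun _ => 1) := by
        funext t
        simp [hK, indicator]
      rw [e1]
      exact (lintegral_indicator_one_le _).trans (h.logMeasure_preimage_le v)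
    calc ∫⁻ t, F (ρ t) ^ p ∂logMeasure
        ≤ ∫⁻ t, κ * D ^ p * ∫⁻ v, K t v * F v ^ p ∂logMeasure ∂logMeasure := by
          refine lintegral_mono_ae ?_
          have hpos := ae_pos_logMeasure univ
          rw [Measure.restrict_univ] at hpos
          filter_upwards [hpos] with t ht
          have hρ := h.pos t ht
          have h1 := hκ (ρ t) (F (ρ t) ^ p) (fun w => D ^ p * F w ^ p) hρ fun w hw => by
            rw [← ENNReal.mul_rpow_of_nonneg _ _ hp.le]
            exact ENNReal.rpow_le_rpow (hF _ w hρ hw) hp.le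
          rw [logNorm_const_mul hDp, logNorm, eLpNorm_one_eq_lintegral_enorm, ← mul_assoc] at h1
          refine h1.trans (mul_le_mul_right (le_of_eq ?_) _)
          rw [← lintegral_indicator measurableSet_Ioo]
          refine lintegral_congr fun v => ?_
          by_cases hv : ρ t < v ∧ v < 2 * ρ t <;> simp [hK, indicator, ht, hv]
      _ = κ * D ^ p * ∫⁻ t, ∫⁻ v, K t v * F v ^ p ∂logMeasure ∂logMeasure :=
          lintegral_const_mul' _ _ (by finiteness)
      _ ≤ κ * D ^ p * (S * ∫⁻ v, F v ^ p ∂logMeasure) := by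
          gcongr
          exact lintegral_lintegral_mul_le hKm (by fun_prop) hKS
      _ = _ := by ring

/-- The dual argument: F(v)^p is averaged over the interval (τ, 2τ) on which ρ is comparable with v.
The interval is then enlarged to all t with ρ(t) within a factor 4R of v, because this relation is
jointly measurable and its sections in v are intervals of logarithmic length 2 log(4R). -/
theorem exists_logNorm_le_comp (h : IsRegularVariable ρ R) {r : ℝ≥0∞} (hr : 0 < r) (D : ℝ≥0) :
    ∃ C : ℝ≥0, ∀ F : ℝ → ℝ≥0∞, Measurable F →
      (∀ v w : ℝ, 0 < v → 0 < w → v ≤ 4 * R * w → w ≤ 4 * R * v → F v ≤ D * F w) →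
      logNorm r (Ioi 0) F ≤ C * logNorm r (Ioi 0) (fun t => F (ρ t)) := by
  have hR := h.one_le
  rcases eq_or_ne r ∞ with rfl | hr'
  · obtain ⟨κ, hκ⟩ := le_logNorm_of_le ENNReal.zero_lt_top
    refine ⟨κ * D, fun F _ hF => logNorm_top_le measurableSet_Ioi fun v hv _ => ?_⟩
    obtain ⟨τ, hτ, hτv⟩ := h.exists_Ioo_near hv
    have h1 := hκ τ (F v) (fun t => D * F (ρ t)) hτ fun t ht =>
      hF v _ hv (h.pos t (hτ.trans ht.1)) (hτv t ht).1.le (hτv t ht).2.le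
    rw [logNorm_const_mul ENNReal.coe_ne_top] at h1
    rw [ENNReal.coe_mul, mul_assoc]
    exact h1.trans (mul_le_mul_right (mul_le_mul_right
      (logNorm_mono_set fun x hx => (hτ.trans hx.1 : 0 < x)) _) _)
  · obtain ⟨κ, hκ⟩ := le_logNorm_of_le (q := 1) one_pos
    set p := r.toReal with hp_def
    have hp : 0 < p := ENNReal.toReal_pos hr.ne' hr'
    set S := ENNReal.ofReal (2 * Real.log (4 * R)) with hS
    have hDp : (D : ℝ≥0∞) ^ p ≠ ∞ := ENNReal.rpow_ne_top_of_nonneg hp.le ENNReal.coe_ne_top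
    have hC : (κ * (D : ℝ≥0∞) ^ p * S) ^ (1 / p) ≠ ∞ :=
      ENNReal.rpow_ne_top_of_nonneg (by positivity) (by finiteness)
    refine ⟨((κ * (D : ℝ≥0∞) ^ p * S) ^ (1 / p)).toNNReal, fun F hFm hF => ?_⟩
    rw [ENNReal.coe_toNNReal hC]
    refine logNorm_le_of_lintegral_le hr.ne' hr' ?_
    rw [← hp_def]
    set K : ℝ → ℝ → ℝ≥0∞ := fun v t =>
      {z : ℝ × ℝ | 0 < z.2 ∧ z.1 < 4 * R * ρ z.2 ∧ ρ z.2 < 4 * R * z.1}.indicator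
        (fun _ => 1) (v, t) with hK
    have hρm := h.measurable
    have hKm : Measurable (Function.uncurry K) := by
      refine Measurable.indicator (by fun_prop) ?_
      exact (measurableSet_lt measurable_const measurable_snd).inter
        ((measurableSet_lt measurable_fst ((hρm.comp measurable_snd).const_mul _)).inter
        (measurableSet_lt (hρm.comp measurable_snd) (measurable_fst.const_mul _)))
    have hKS : ∀ t : ℝ, 0 < t → ∫⁻ v, K v t ∂logMeasure ≤ S := by
      intro t ht
      have hρ := h.pos t ht
      have e1 : (fun v => K v t) =
          (Ioo (ρ t / (4 * R)) (4 * R * ρ t)).indicator (fun _ => 1) := by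
        funext v
        have : ρ t < 4 * R * v ↔ ρ t / (4 * R) < v := by
          rw [div_lt_iff₀ (by positivity), mul_comm v]
        simp [hK, indicator, ht, this, and_comm]
      rw [e1]
      refine (lintegral_indicator_one_le _).trans ?_
      rw [logMeasure_Ioo (by positivity) (by positivity),
        Real.log_mul (by positivity) hρ.ne', Real.log_div hρ.ne' (by positivity)]
      exact ENNReal.ofReal_le_ofReal (by linarith)
    calc ∫⁻ v, F v ^ p ∂logMeasure
        ≤ ∫⁻ v, κ * D ^ p * ∫⁻ t, K v t * F (ρ t) ^ p ∂logMeasure ∂logMeasure := by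
          refine lintegral_mono_ae ?_
          have hpos := ae_pos_logMeasure univ
          rw [Measure.restrict_univ] at hpos
          filter_upwards [hpos] with v hv
          obtain ⟨τ, hτ, hτv⟩ := h.exists_Ioo_near hv
          have h1 := hκ τ (F v ^ p) (fun t => D ^ p * F (ρ t) ^ p) hτ fun t ht => by
            rw [← ENNReal.mul_rpow_of_nonneg _ _ hp.le]
            exact ENNReal.rpow_le_rpow (hF v _ hv (h.pos t (hτ.trans ht.1)) (hτv t ht).1.le
              (hτv t ht).2.le) hp.le
          rw [logNorm_const_mul hDp, logNorm, eLpNorm_one_eq_lintegral_enorm, ← mul_assoc] at h1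
          refine h1.trans (mul_le_mul_right ?_ _)
          rw [← lintegral_indicator measurableSet_Ioo]
          refine lintegral_mono fun t => ?_
          by_cases ht : t ∈ Ioo τ (2 * τ)
          · have h0 : 0 < t := hτ.trans ht.1
            simp [hK, indicator, ht.1, ht.2, h0, hτv t ht]
          · simp [indicator_of_notMem ht]
      _ = κ * D ^ p * ∫⁻ v, ∫⁻ t, K v t * F (ρ t) ^ p ∂logMeasure ∂logMeasure :=
          lintegral_const_mul' _ _ (by finiteness)
      _ ≤ κ * D ^ p * (S * ∫⁻ t, F (ρ t) ^ p ∂logMeasure) := by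
          gcongr
          exact lintegral_lintegral_mul_le hKm (by fun_prop) hKS
      _ = _ := by ring

end IsRegularVariable

end ChangeOfVariables

/-! ### Peetre's functional -/

section Peetre

variable {V : Type*} [AddCommGroup V] {A₀ A₁ : V → ℝ≥0∞}

theorem peetreK_le {t : ℝ} {f f₀ f₁ : V} (h : f₀ + f₁ = f) :
    peetreK A₀ A₁ t f ≤ A₀ f₀ + ENNReal.ofReal t * A₁ f₁ :=
  iInf_le_of_le f₀ (iInf_le_of_le f₁ (iInf_le _ h))

theorem le_peetreK {t : ℝ} {f : V} {x : ℝ≥0∞}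
    (h : ∀ f₀ f₁ : V, f₀ + f₁ = f → x ≤ A₀ f₀ + ENNReal.ofReal t * A₁ f₁) :
    x ≤ peetreK A₀ A₁ t f :=
  le_iInf fun f₀ => le_iInf fun f₁ => le_iInf fun hf => h f₀ f₁ hf

theorem monotone_peetreK (A₀ A₁ : V → ℝ≥0∞) (f : V) : Monotone fun t => peetreK A₀ A₁ t f :=
  fun _ _ hst => le_peetreK fun _ _ hf => (peetreK_le hf).trans (by gcongr)

@[fun_prop]
theorem measurable_peetreK (A₀ A₁ : V → ℝ≥0∞) (f : V) : Measurable fun t => peetreK A₀ A₁ t f :=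
  (monotone_peetreK A₀ A₁ f).measurable

theorem peetreK_le_mul (A₀ A₁ : V → ℝ≥0∞) (f : V) {s t c : ℝ} (hc : 1 ≤ c) (h : t ≤ c * s) :
    peetreK A₀ A₁ t f ≤ ENNReal.ofReal c * peetreK A₀ A₁ s f := by
  have hc0 : ENNReal.ofReal c ≠ 0 := by simpa using one_pos.trans_le hc
  rw [← ENNReal.div_le_iff' hc0 ENNReal.ofReal_ne_top]
  refine le_peetreK fun f₀ f₁ hf => ?_
  rw [ENNReal.div_le_iff' hc0 ENNReal.ofReal_ne_top]
  calc peetreK A₀ A₁ t f ≤ A₀ f₀ + ENNReal.ofReal t * A₁ f₁ := peetreK_le hf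
    _ ≤ ENNReal.ofReal c * A₀ f₀ + ENNReal.ofReal (c * s) * A₁ f₁ := by
      gcongr
      exact le_mul_of_one_le_left' (ENNReal.one_le_ofReal.2 hc)
    _ = _ := by
      rw [ENNReal.ofReal_mul (by linarith)]
      ring

theorem ofReal_div_mul_peetreK_le (A₀ A₁ : V → ℝ≥0∞) (f : V) {s t : ℝ} (hs : 0 < s)
    (hst : s ≤ t) : ENNReal.ofReal (s / t) * peetreK A₀ A₁ t f ≤ peetreK A₀ A₁ s f := by
  have ht := hs.trans_le hst
  calc ENNReal.ofReal (s / t) * peetreK A₀ A₁ t f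
      ≤ ENNReal.ofReal (s / t) * (ENNReal.ofReal (t / s) * peetreK A₀ A₁ s f) := by
        gcongr
        exact peetreK_le_mul A₀ A₁ f ((one_le_div hs).2 hst) (by rw [div_mul_cancel₀ _ hs.ne'])
    _ = peetreK A₀ A₁ s f := by
      rw [← mul_assoc, ← ENNReal.ofReal_mul (by positivity)]
      have : s / t * (t / s) = 1 := by field_simp
      rw [this, ENNReal.ofReal_one, one_mul]

variable {𝕜 : Type*} [RCLike 𝕜] [Module 𝕜 V] [TopologicalSpace V]

theorem IsQuasiBanachSubspace.map_zero {A : V → ℝ≥0∞} (hA : IsQuasiBanachSubspace 𝕜 A) :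
    A 0 = 0 := (hA.eq_zero_iff 0).2 rfl

theorem IsQuasiBanachSubspace.map_neg {A : V → ℝ≥0∞} (hA : IsQuasiBanachSubspace 𝕜 A) (f : V) :
    A (-f) = A f := by
  have := hA.smul_eq (-1) f
  simpa using this

theorem exists_peetreK_add_le (hA₀ : IsQuasiBanachSubspace 𝕜 A₀)
    (hA₁ : IsQuasiBanachSubspace 𝕜 A₁) :
    ∃ C : ℝ≥0, ∀ (t : ℝ) (f g : V),
      peetreK A₀ A₁ t (f + g) ≤ C * (peetreK A₀ A₁ t f + peetreK A₀ A₁ t g) := by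
  obtain ⟨C, hC1, hC⟩ := hA₀.quasi_triangle
  obtain ⟨D, hD1, hD⟩ := hA₁.quasi_triangle
  have h0 : ((C + D : ℝ≥0) : ℝ≥0∞) ≠ 0 := by
    have : 0 < C + D := add_pos_of_pos_of_nonneg (one_pos.trans_le hC1) zero_le
    simpa using this.ne'
  refine ⟨C + D, fun t f g => ?_⟩
  -- Dividing and subtracting isolates one K-functional at a time on the right, so that each infimum
  -- can be tested on a single decomposition; truncated subtraction keeps this valid for infinite
  -- values.
  rw [← ENNReal.div_le_iff' h0 ENNReal.coe_ne_top, ← tsub_le_iff_left]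
  refine le_peetreK fun g₀ g₁ hg => ?_
  rw [tsub_le_iff_left, ← tsub_le_iff_right]
  refine le_peetreK fun f₀ f₁ hf => ?_
  rw [tsub_le_iff_right, ENNReal.div_le_iff' h0 ENNReal.coe_ne_top]
  have hfg : (f₀ + g₀) + (f₁ + g₁) = f + g := by rw [← hf, ← hg]; abel
  calc peetreK A₀ A₁ t (f + g)
      ≤ A₀ (f₀ + g₀) + ENNReal.ofReal t * A₁ (f₁ + g₁) := peetreK_le hfg
    _ ≤ C * (A₀ f₀ + A₀ g₀) + ENNReal.ofReal t * (D * (A₁ f₁ + A₁ g₁)) := by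
        gcongr
        · exact hC _ _
        · exact hD _ _
    _ ≤ (C + D) * (A₀ f₀ + A₀ g₀) + ENNReal.ofReal t * ((C + D) * (A₁ f₁ + A₁ g₁)) := by
        gcongr
        · exact le_self_add
        · exact le_add_self
    _ = _ := by push_cast; ring

theorem peetreK_le_left (hA₁ : IsQuasiBanachSubspace 𝕜 A₁) (t : ℝ) (f : V) :
    peetreK A₀ A₁ t f ≤ A₀ f := by
  simpa [hA₁.map_zero] using peetreK_le (A₀ := A₀) (A₁ := A₁) (t := t) (add_zero f)

theorem peetreK_le_right (hA₀ : IsQuasiBanachSubspace 𝕜 A₀) (t : ℝ) (f : V) :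
    peetreK A₀ A₁ t f ≤ ENNReal.ofReal t * A₁ f := by
  simpa [hA₀.map_zero] using peetreK_le (A₀ := A₀) (A₁ := A₁) (t := t) (zero_add f)

end Peetre

/-! ### The parameters of the limiting space -/

/-- Admissible parameters of the limiting space `A^R_{1,r,b,q,a}`. -/
structure LimitingParameters (r : ℝ≥0∞) (b : ℝ → ℝ) (q : ℝ≥0∞) (a : ℝ → ℝ) : Prop where
  r_pos : 0 < r
  q_pos : 0 < q
  slow_b : IsSlowlyVarying b
  slow_a : IsSlowlyVarying a
  finite : nestedNorm r b q a 1 < ∞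

/-- The function `b` with values in `[0, ∞]`. -/
noncomputable abbrev ofRealFun (b : ℝ → ℝ) : ℝ → ℝ≥0∞ := fun u => ENNReal.ofReal (b u)

namespace LimitingParameters

variable {r q : ℝ≥0∞} {b a : ℝ → ℝ}

/-- Finiteness at 1 spreads to t ≤ 1 by monotonicity and to t ≥ 1 by the dilation bound. -/
theorem chi_ne_top (h : LimitingParameters r b q a) (t : ℝ) :
    chi r (ofRealFun b) q (ofRealFun a) t ≠ ∞ := by
  have hfin := h.finite
  rw [nestedNorm_eq_chi h.r_pos h.q_pos] at hfin
  rcases le_total t 1 with h1 | h1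
  · exact ((monotone_chi h1).trans_lt hfin).ne
  · obtain ⟨C, hC⟩ := exists_chi_mul_le (r := r) (q := q) (h.slow_b.powerBound one_pos)
      (h.slow_a.powerBound one_pos)
    have := hC t 1 h1 one_pos
    rw [mul_one] at this
    exact ne_top_of_le_ne_top (by finiteness) this

theorem exists_mul_logNorm_le (h : LimitingParameters r b q a) :
    ∃ C : ℝ≥0, ∀ t : ℝ, 0 < t →
      ofRealFun a t * logNorm r (Ioo 0 t) (ofRealFun b) ≤
        C * chi r (ofRealFun b) q (ofRealFun a) t :=
  exists_mul_logNorm_le_chi h.q_pos (h.slow_b.powerBound one_pos)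
    (h.slow_a.powerBound one_pos) h.slow_b.aemeasurable

theorem exists_le_logNorm (h : LimitingParameters r b q a) :
    ∃ C : ℝ≥0, ∀ t : ℝ, 0 < t →
      ofRealFun b t ≤ C * logNorm r (Ioo 0 t) (ofRealFun b) :=
  exists_le_logNorm_Ioo_zero h.r_pos (h.slow_b.powerBound one_pos)

theorem logNorm_ne_top (h : LimitingParameters r b q a) {t : ℝ} (ht : 0 < t) :
    logNorm r (Ioo 0 t) (ofRealFun b) ≠ ∞ := by
  obtain ⟨C, hC⟩ := h.exists_mul_logNorm_le
  have h1 := ne_top_of_le_ne_top (ENNReal.mul_ne_top ENNReal.coe_ne_top (h.chi_ne_top t)) (hC t ht)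
  intro h2
  rw [h2, ENNReal.mul_top (by simpa using h.slow_a.pos t ht)] at h1
  exact h1 rfl

theorem chi_ne_zero (h : LimitingParameters r b q a) {t : ℝ} (ht : 0 < t) :
    chi r (ofRealFun b) q (ofRealFun a) t ≠ 0 := by
  obtain ⟨C, hC⟩ := h.exists_mul_logNorm_le
  obtain ⟨D, hD⟩ := h.exists_le_logNorm
  intro h0
  have h1 := hC t ht
  rw [h0, mul_zero, nonpos_iff_eq_zero, mul_eq_zero] at h1
  rcases h1 with h1 | h1
  · exact absurd h1 (by simpa using h.slow_a.pos t ht)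
  · have h2 := hD t ht
    rw [h1, mul_zero, nonpos_iff_eq_zero] at h2
    exact absurd h2 (by simpa using h.slow_b.pos t ht)

theorem ofReal_chiOne (h : LimitingParameters r b q a) (t : ℝ) :
    ENNReal.ofReal (chiOne r b q a t) = chi r (ofRealFun b) q (ofRealFun a) t := by
  rw [chiOne, nestedNorm_eq_chi h.r_pos h.q_pos, ENNReal.ofReal_toReal (h.chi_ne_top t)]

theorem chiOne_pos (h : LimitingParameters r b q a) {t : ℝ} (ht : 0 < t) :
    0 < chiOne r b q a t := by
  rw [← ENNReal.ofReal_pos, h.ofReal_chiOne t]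
  exact (h.chi_ne_zero ht).bot_lt

theorem rhoOne_pos (h : LimitingParameters r b q a) {t : ℝ} (ht : 0 < t) :
    0 < rhoOne r b q a t := div_pos ht (h.chiOne_pos ht)

theorem ofReal_inv_rhoOne (h : LimitingParameters r b q a) {t : ℝ} (ht : 0 < t) :
    ENNReal.ofReal (rhoOne r b q a t)⁻¹ =
      ENNReal.ofReal t⁻¹ * chi r (ofRealFun b) q (ofRealFun a) t := by
  rw [← h.ofReal_chiOne t, ← ENNReal.ofReal_mul (by positivity), rhoOne, inv_div, mul_comm,
    div_eq_mul_inv]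

/-- As ρ = t/χ, monotonicity of χ gives growth at most like t. Exponents 1/4 for both slowly varying
functions let χ grow at most like t^{1/2}, which leaves at least t^{1/2} for ρ. -/
theorem exists_isRegularVariable (h : LimitingParameters r b q a) :
    ∃ R : ℝ, IsRegularVariable (rhoOne r b q a) R := by
  obtain ⟨C, hC⟩ := exists_chi_mul_le (r := r) (q := q)
    (h.slow_b.powerBound (ε := 1 / 4) (by norm_num))
    (h.slow_a.powerBound (ε := 1 / 4) (by norm_num))
  refine ⟨max 1 C, ?_, le_max_left _ _, fun _ => h.rhoOne_pos, fun s t hs hst => ?_,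
    fun s t hs hst => ?_⟩
  · have : chiOne r b q a = fun t => (chi r (ofRealFun b) q (ofRealFun a) t).toReal := by
      funext t
      rw [chiOne, nestedNorm_eq_chi h.r_pos h.q_pos]
    have hm : Measurable (chiOne r b q a) := by
      rw [this]
      exact monotone_chi.measurable.ennreal_toReal
    exact measurable_id.div hm
  · have ht := hs.trans_le hst
    have h1 : chiOne r b q a s ≤ chiOne r b q a t := by
      rw [← ENNReal.ofReal_le_ofReal_iff (h.chiOne_pos ht).le, h.ofReal_chiOne s,
        h.ofReal_chiOne t]
      exact monotone_chi hst
    have hχ := h.chiOne_pos hs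
    rw [rhoOne, rhoOne, div_mul_div_cancel₀ hs.ne']
    gcongr
  · have ht := hs.trans_le hst
    have h1 : chiOne r b q a t ≤ max 1 (C : ℝ) * (t / s) ^ (1 / 2 : ℝ) * chiOne r b q a s := by
      have hχ := h.chiOne_pos hs
      have h2 := hC (t / s) s ((one_le_div hs).2 hst) hs
      rw [div_mul_cancel₀ _ hs.ne'] at h2
      norm_num only at h2
      rw [← ENNReal.ofReal_le_ofReal_iff (by positivity), h.ofReal_chiOne t,
        ENNReal.ofReal_mul (by positivity), ENNReal.ofReal_mul (by positivity),
        h.ofReal_chiOne s]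
      refine h2.trans ?_
      gcongr
      rw [← ENNReal.ofReal_coe_nnreal]
      exact ENNReal.ofReal_le_ofReal (le_max_right _ _)
    have hχs := h.chiOne_pos hs
    have hχt := h.chiOne_pos ht
    have e : (t / s) ^ (1 / 2 : ℝ) * (t / s) ^ (1 / 2 : ℝ) = t / s := by
      rw [← Real.rpow_add (by positivity)]; norm_num
    rw [rhoOne, rhoOne, mul_div_assoc', mul_div_assoc', div_le_div_iff₀ hχs hχt]
    calc (t / s) ^ (1 / 2 : ℝ) * s * chiOne r b q a t
        ≤ (t / s) ^ (1 / 2 : ℝ) * s *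
          (max 1 (C : ℝ) * (t / s) ^ (1 / 2 : ℝ) * chiOne r b q a s) := by gcongr
      _ = max 1 (C : ℝ) * (((t / s) ^ (1 / 2 : ℝ) * (t / s) ^ (1 / 2 : ℝ)) * s) *
          chiOne r b q a s := by ring
      _ = _ := by rw [e, div_mul_cancel₀ _ hs.ne']

/-! ### The Holmstedt-type formula for the couple (A₀, A^R_{1,r,b,q,a}). -/

section Space

variable {V : Type*} [AddCommGroup V] {A₀ A₁ : V → ℝ≥0∞}

theorem tailNorm_eq (hq : 0 < q) (a : ℝ → ℝ) (F : ℝ → ℝ≥0∞) {t : ℝ} (ht : 0 ≤ t) :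
    lqNorm q (Ioi t) (fun u => weight 1 q a u * F u) = tailNorm q (ofRealFun a) F t := by
  rw [lqNorm_weight_mul hq (Ioi_subset_Ioi ht) measurableSet_Ioi, tailNorm]
  simp only [Real.rpow_neg_one]

theorem iteratedTailNorm_eq (hr : 0 < r) (hq : 0 < q) (b a : ℝ → ℝ) (F : ℝ → ℝ≥0∞) {t : ℝ}
    (ht : 0 ≤ t) :
    lqNorm r (Ioi t) (fun s => weight 0 r b s *
      lqNorm q (Ioi s) (fun u => weight 1 q a u * F u)) =
      iteratedTailNorm r (ofRealFun b) q (ofRealFun a) F t := by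
  rw [lqNorm_weight_zero_mul hr (Ioi_subset_Ioi ht) measurableSet_Ioi, iteratedTailNorm]
  exact logNorm_congr measurableSet_Ioi fun s _ hs => by rw [tailNorm_eq hq a F hs.le]

variable {𝕜 : Type*} [RCLike 𝕜] [Module 𝕜 V] [TopologicalSpace V]

/-- Holmstedt-type formula for the couple `(A₀, A^R_{1,r,b,q,a})`. -/
theorem exists_holmstedt (h : LimitingParameters r b q a) (hA₀ : IsQuasiBanachSubspace 𝕜 A₀)
    (hA₁ : IsQuasiBanachSubspace 𝕜 A₁) :
    ∃ C : ℝ≥0, ∀ (f : V) (t : ℝ), 0 < t →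
      ENNReal.ofReal t⁻¹ * chi r (ofRealFun b) q (ofRealFun a) t *
          peetreK A₀ (spaceR A₀ A₁ 1 r b q a) (rhoOne r b q a t) f ≤
        C * (ENNReal.ofReal t⁻¹ * chi r (ofRealFun b) q (ofRealFun a) t * peetreK A₀ A₁ t f +
          logNorm r (Ioo 0 t) (ofRealFun b) *
            tailNorm q (ofRealFun a) (fun u => peetreK A₀ A₁ u f) t +
          iteratedTailNorm r (ofRealFun b) q (ofRealFun a) (fun u => peetreK A₀ A₁ u f) t) ∧
      ENNReal.ofReal t⁻¹ * chi r (ofRealFun b) q (ofRealFun a) t * peetreK A₀ A₁ t f +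
          logNorm r (Ioo 0 t) (ofRealFun b) *
            tailNorm q (ofRealFun a) (fun u => peetreK A₀ A₁ u f) t +
          iteratedTailNorm r (ofRealFun b) q (ofRealFun a) (fun u => peetreK A₀ A₁ u f) t ≤
        C * (ENNReal.ofReal t⁻¹ * chi r (ofRealFun b) q (ofRealFun a) t *
          peetreK A₀ (spaceR A₀ A₁ 1 r b q a) (rhoOne r b q a t) f) := by
  obtain ⟨c, hc⟩ := exists_peetreK_add_le hA₀ hA₁
  have h4 : (0 : ℝ) < 1 / 4 := by norm_num
  obtain ⟨C, hC⟩ := exists_iteratedTailNorm_zero_le h.r_pos h.q_pos (h.slow_b.powerBound h4)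
    (h.slow_a.powerBound h4) (h.slow_a.powerBound one_half_pos) h.slow_b.aemeasurable
    h.slow_a.aemeasurable c
  obtain ⟨D, hD⟩ := exists_le_iteratedTailNorm_zero h.r_pos h.q_pos (h.slow_b.powerBound h4)
    (h.slow_a.powerBound h4) (h.slow_a.powerBound one_half_pos) h.slow_b.aemeasurable
    h.slow_a.aemeasurable c
  have hX : ∀ g : V, spaceR A₀ A₁ 1 r b q a g =
      iteratedTailNorm r (ofRealFun b) q (ofRealFun a) (fun u => peetreK A₀ A₁ u g) 0 :=
    fun g => iteratedTailNorm_eq h.r_pos h.q_pos b a _ le_rfl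
  refine ⟨1 + C + D, fun f t ht => ?_⟩
  -- The normalisation α ρ(t) = 1 with α = χ(t)/t: after multiplication by α, the norm in the
  -- limiting space enters with coefficient 1.
  have hρ : ENNReal.ofReal t⁻¹ * chi r (ofRealFun b) q (ofRealFun a) t *
      ENNReal.ofReal (rhoOne r b q a t) = 1 := by
    rw [← h.ofReal_inv_rhoOne ht, ← ENNReal.ofReal_mul (inv_pos.2 (h.rhoOne_pos ht)).le,
      inv_mul_cancel₀ (h.rhoOne_pos ht).ne', ENNReal.ofReal_one]
  have hα0 : ENNReal.ofReal t⁻¹ * chi r (ofRealFun b) q (ofRealFun a) t ≠ 0 :=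
    mul_ne_zero (by simpa using ht) (h.chi_ne_zero ht)
  have hαt : ENNReal.ofReal t⁻¹ * chi r (ofRealFun b) q (ofRealFun a) t ≠ ∞ :=
    ENNReal.mul_ne_top ENNReal.ofReal_ne_top (h.chi_ne_top t)
  obtain ⟨α, hα⟩ : ∃ x, x = ENNReal.ofReal t⁻¹ * chi r (ofRealFun b) q (ofRealFun a) t := ⟨_, rfl⟩
  obtain ⟨Q, hQ⟩ : ∃ x, x = logNorm r (Ioo 0 t) (ofRealFun b) *
    tailNorm q (ofRealFun a) (fun u => peetreK A₀ A₁ u f) t := ⟨_, rfl⟩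
  obtain ⟨T, hT⟩ : ∃ x, x = iteratedTailNorm r (ofRealFun b) q (ofRealFun a)
    (fun u => peetreK A₀ A₁ u f) t := ⟨_, rfl⟩
  have hE0 : ((1 + C + D : ℝ≥0) : ℝ≥0∞) ≠ 0 := by
    rw [ENNReal.coe_ne_zero]
    positivity
  rw [← hα] at hρ hα0 hαt
  rw [← hα, ← hQ, ← hT]
  constructor
  -- K(t, f; A₀, A₁) is isolated on the right, so that an arbitrary decomposition for it can be
  -- tested and the inequality then restored.
  · rw [← ENNReal.div_le_iff' hE0 ENNReal.coe_ne_top, add_assoc (α * _) Q T, ← tsub_le_iff_right,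
      ← ENNReal.div_le_iff' hα0 hαt]
    refine le_peetreK fun f₀ f₁ hf => ?_
    rw [ENNReal.div_le_iff' hα0 hαt, tsub_le_iff_right, ← add_assoc (α * _) Q T,
      ENNReal.div_le_iff' hE0 ENNReal.coe_ne_top]
    obtain ⟨M, hM⟩ : ∃ x, x = A₀ f₀ + ENNReal.ofReal t * A₁ f₁ := ⟨_, rfl⟩
    -- The two bounds required of K(u, f₁) come from f₁ itself and from f₁ = f - f₀.
    have key := hC (fun u => peetreK A₀ A₁ u f) (fun u => peetreK A₀ A₁ u f₁) M t ht
      (by fun_prop) (by fun_prop) (fun u hu => ?_) (fun u hu => ?_)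
    · rw [← hα, ← hQ, ← hT, ← hX] at key
      rw [← hM]
      calc α * peetreK A₀ (spaceR A₀ A₁ 1 r b q a) (rhoOne r b q a t) f
          ≤ α * (A₀ f₀ + ENNReal.ofReal (rhoOne r b q a t) * spaceR A₀ A₁ 1 r b q a f₁) :=
            mul_le_mul_right (peetreK_le hf) _
        _ = α * A₀ f₀ + (α * ENNReal.ofReal (rhoOne r b q a t)) *
            spaceR A₀ A₁ 1 r b q a f₁ := by ring
        _ ≤ α * M + C * (α * M + Q + T) := by
            rw [hρ, one_mul]
            exact add_le_add (mul_le_mul_right (hM ▸ le_self_add) _) key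
        _ ≤ 1 * (α * M + Q + T) + C * (α * M + Q + T) + D * (α * M + Q + T) := by
            rw [one_mul]
            refine le_trans (add_le_add_left ?_ _) le_self_add
            exact le_self_add.trans le_self_add
        _ = _ := by push_cast; ring
    · calc peetreK A₀ A₁ u f₁ ≤ ENNReal.ofReal u * A₁ f₁ := peetreK_le_right hA₀ u f₁
        _ = ENNReal.ofReal (u / t) * (ENNReal.ofReal t * A₁ f₁) := by
          rw [← mul_assoc, ← ENNReal.ofReal_mul (by positivity), div_mul_cancel₀ _ ht.ne']
        _ ≤ _ := mul_le_mul_right (hM ▸ le_add_self) _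
    · have h1 := hc u f (-f₀)
      have h2 : f + -f₀ = f₁ := by rw [← hf]; abel
      rw [h2] at h1
      refine h1.trans (mul_le_mul_right (add_le_add_right ?_ _) _)
      calc peetreK A₀ A₁ u (-f₀) ≤ A₀ (-f₀) := peetreK_le_left hA₁ u _
        _ = A₀ f₀ := hA₀.map_neg f₀
        _ ≤ M := hM ▸ le_self_add
  · rw [← mul_assoc, ← ENNReal.div_le_iff' (mul_ne_zero hE0 hα0)
      (ENNReal.mul_ne_top ENNReal.coe_ne_top hαt)]
    refine le_peetreK fun g₀ g₁ hg => ?_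
    rw [ENNReal.div_le_iff' (mul_ne_zero hE0 hα0) (ENNReal.mul_ne_top ENNReal.coe_ne_top hαt)]
    -- Here K(u, f) ≤ c (K(u, g₁) + K(u, g₀)), and K(u, g₀) is at most the A₀-norm of g₀ for all u.
    have key := hD (fun u => peetreK A₀ A₁ u f) (fun u => peetreK A₀ A₁ u g₁) (A₀ g₀) t ht
      (by fun_prop) (fun u hu hut => ofReal_div_mul_peetreK_le A₀ A₁ g₁ hu hut) (fun u _ => ?_)
    · rw [← hα, ← hQ, ← hT, ← hX] at key
      calc α * peetreK A₀ A₁ t f + Q + T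
          ≤ D * (α * A₀ g₀ + spaceR A₀ A₁ 1 r b q a g₁) := key
        _ = D * (α * A₀ g₀ + (α * ENNReal.ofReal (rhoOne r b q a t)) *
            spaceR A₀ A₁ 1 r b q a g₁) := by rw [hρ, one_mul]
        _ = D * (α * (A₀ g₀ + ENNReal.ofReal (rhoOne r b q a t) *
            spaceR A₀ A₁ 1 r b q a g₁)) := by ring
        _ ≤ (1 + C + D : ℝ≥0) * (α * (A₀ g₀ + ENNReal.ofReal (rhoOne r b q a t) *
            spaceR A₀ A₁ 1 r b q a g₁)) := by
            refine mul_le_mul_left ?_ _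
            exact_mod_cast le_add_self
        _ = _ := by ring
    · have h1 := hc u g₁ g₀
      rw [add_comm g₁, hg] at h1
      exact h1.trans (mul_le_mul_right (add_le_add_right (peetreK_le_left hA₁ u _) _) _)

end Space

end LimitingParameters

/-! ### Invariance of the spaces under equivalence of the weights -/

namespace EquivOnPos

variable {b b' : ℝ → ℝ}

theorem symm (h : EquivOnPos b b') : EquivOnPos b' b := by
  obtain ⟨C, hC, h⟩ := h
  exact ⟨C, hC, fun t ht => (h t ht).symm⟩

theorem mul_left (h : EquivOnPos b b') {c : ℝ → ℝ} (hc : ∀ t : ℝ, 0 < t → 0 ≤ c t) :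
    EquivOnPos (fun t => c t * b t) (fun t => c t * b' t) := by
  obtain ⟨C, hC, h⟩ := h
  refine ⟨C, hC, fun t ht => ⟨?_, ?_⟩⟩
  · rw [mul_left_comm]
    exact mul_le_mul_of_nonneg_left (h t ht).1 (hc t ht)
  · rw [mul_left_comm]
    exact mul_le_mul_of_nonneg_left (h t ht).2 (hc t ht)

theorem comp (h : EquivOnPos b b') {ρ : ℝ → ℝ} (hρ : ∀ t : ℝ, 0 < t → 0 < ρ t) :
    EquivOnPos (b ∘ ρ) (b' ∘ ρ) := by
  obtain ⟨C, hC, h⟩ := h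
  exact ⟨C, hC, fun t ht => h (ρ t) (hρ t ht)⟩

/-- Weighted norms over subsets of the half-line depend on the weight only up to equivalence. -/
theorem exists_lqNorm_le (h : EquivOnPos b b') (θ : ℝ) (q : ℝ≥0∞) {I : Set ℝ}
    (hI : MeasurableSet I) (hI0 : I ⊆ Ioi 0) :
    ∃ C : ℝ≥0, ∀ F : ℝ → ℝ≥0∞,
      lqNorm q I (fun u => weight θ q b u * F u) ≤
        C * lqNorm q I (fun u => weight θ q b' u * F u) := by
  obtain ⟨C, hC, h⟩ := h
  refine ⟨C.toNNReal, fun F => ?_⟩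
  refine eLpNorm_le_nnreal_smul_eLpNorm_of_ae_le_mul' ?_ q
  filter_upwards [ae_restrict_mem hI] with u hu
  have hu0 : 0 < u := hI0 hu
  simp only [enorm_eq_self]
  rw [← mul_assoc]
  refine mul_le_mul_left ?_ _
  change _ ≤ ENNReal.ofReal C * _
  rw [weight, weight, ← ENNReal.ofReal_mul hC.le]
  refine ENNReal.ofReal_le_ofReal ?_
  rw [mul_left_comm]
  exact mul_le_mul_of_nonneg_left (h u hu0).1 (by positivity)

end EquivOnPos

section Congruence

variable {V : Type*} [AddCommGroup V]

theorem ContEmbedded.trans {V : Type*} {X Y Z : V → ℝ≥0∞} (h₁ : ContEmbedded X Y)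
    (h₂ : ContEmbedded Y Z) : ContEmbedded X Z := by
  obtain ⟨C, hC⟩ := h₁
  obtain ⟨D, hD⟩ := h₂
  refine ⟨D * C, fun f hf => ?_⟩
  rw [ENNReal.coe_mul, mul_assoc]
  exact (hD f ((hC f hf).trans_lt (ENNReal.mul_lt_top ENNReal.coe_lt_top hf))).trans
    (mul_le_mul_right (hC f hf) _)

theorem SameSpace.trans {V : Type*} {X Y Z : V → ℝ≥0∞} (h₁ : SameSpace X Y)
    (h₂ : SameSpace Y Z) : SameSpace X Z :=
  ⟨h₁.1.trans h₂.1, h₂.2.trans h₁.2⟩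

theorem ContEmbedded.inter {V : Type*} {X Y X' Y' : V → ℝ≥0∞} (h₁ : ContEmbedded X X')
    (h₂ : ContEmbedded Y Y') : ContEmbedded (interSpace X Y) (interSpace X' Y') := by
  obtain ⟨C, hC⟩ := h₁
  obtain ⟨D, hD⟩ := h₂
  refine ⟨max C D, fun f hf => ?_⟩
  obtain ⟨hX, hY⟩ := max_lt_iff.1 hf
  refine max_le ((hC f hX).trans ?_) ((hD f hY).trans ?_)
  · exact mul_le_mul' (ENNReal.coe_le_coe.2 (le_max_left _ _)) (le_max_left _ _)
  · exact mul_le_mul' (ENNReal.coe_le_coe.2 (le_max_right _ _)) (le_max_right _ _)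

theorem SameSpace.inter {V : Type*} {X Y X' Y' : V → ℝ≥0∞} (h₁ : SameSpace X X')
    (h₂ : SameSpace Y Y') : SameSpace (interSpace X Y) (interSpace X' Y') :=
  ⟨h₁.1.inter h₂.1, h₁.2.inter h₂.2⟩

variable (A₀ A₁ : V → ℝ≥0∞) {b b' : ℝ → ℝ}

theorem sameSpace_stdSpace (h : EquivOnPos b b') (θ : ℝ) (q : ℝ≥0∞) :
    SameSpace (stdSpace A₀ A₁ θ q b) (stdSpace A₀ A₁ θ q b') := by
  constructor
  · obtain ⟨C, hC⟩ := h.symm.exists_lqNorm_le θ q measurableSet_Ioi subset_rfl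
    exact ⟨C, fun f _ => hC _⟩
  · obtain ⟨C, hC⟩ := h.exists_lqNorm_le θ q measurableSet_Ioi subset_rfl
    exact ⟨C, fun f _ => hC _⟩

theorem sameSpace_spaceR (h : EquivOnPos b b') (θ : ℝ) (r q : ℝ≥0∞) (a : ℝ → ℝ) :
    SameSpace (spaceR A₀ A₁ θ r b q a) (spaceR A₀ A₁ θ r b' q a) := by
  constructor
  · obtain ⟨C, hC⟩ := h.symm.exists_lqNorm_le 0 r measurableSet_Ioi subset_rfl
    exact ⟨C, fun f _ => hC _⟩
  · obtain ⟨C, hC⟩ := h.exists_lqNorm_le 0 r measurableSet_Ioi subset_rfl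
    exact ⟨C, fun f _ => hC _⟩

theorem sameSpace_spaceRR (h : EquivOnPos b b') (θ : ℝ) (s r q : ℝ≥0∞) (c a : ℝ → ℝ) :
    SameSpace (spaceRR A₀ A₁ θ s b r c q a) (spaceRR A₀ A₁ θ s b' r c q a) := by
  constructor
  · obtain ⟨C, hC⟩ := h.symm.exists_lqNorm_le 0 s measurableSet_Ioi subset_rfl
    exact ⟨C, fun f _ => hC _⟩
  · obtain ⟨C, hC⟩ := h.exists_lqNorm_le 0 s measurableSet_Ioi subset_rfl
    exact ⟨C, fun f _ => hC _⟩

end Congruence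

/-! ### Interpolation of the couple `(A₀, A^R_{1,r,b,q,a})` -/

/-- Slow variation costs half of the exponent η, and the growth t^{1/2} of ρ halves the rest: this
is the origin of η/4. It supplies the growth of the weight that Hardy's inequality needs. -/
theorem IsSlowlyVarying.exists_rpow_mul_comp_le {a : ℝ → ℝ} (ha : IsSlowlyVarying a)
    {ρ : ℝ → ℝ} {R : ℝ} (hρ : IsRegularVariable ρ R) {η : ℝ} (hη : 0 < η) :
    ∃ c : ℝ≥0, ∀ s t : ℝ, 0 < s → s ≤ t →
      ENNReal.ofReal (ρ s ^ η * a (ρ s)) ≤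
        c * ENNReal.ofReal ((s / t) ^ (η / 4)) * ENNReal.ofReal (ρ t ^ η * a (ρ t)) := by
  obtain ⟨C, hC, h⟩ := ha.exists_le (half_pos hη)
  have hR := hρ.one_le
  have hR0 : 0 < R := one_pos.trans_le hR
  refine ⟨(C * (R ^ (η / 2) * R ^ η)).toNNReal, fun s t hs hst => ?_⟩
  change _ ≤ ENNReal.ofReal (C * (R ^ (η / 2) * R ^ η)) * _ * _
  have ht := hs.trans_le hst
  rw [← ENNReal.ofReal_mul (by positivity), ← ENNReal.ofReal_mul (by positivity)]
  refine ENNReal.ofReal_le_ofReal ?_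
  have hx := hρ.pos s hs
  have hy := hρ.pos t ht
  have hax := ha.pos _ hx
  have hay := ha.pos _ hy
  set x := ρ s with hxdef
  set y := ρ t with hydef
  have hxy : x / y ≤ R * (s / t) ^ (1 / 2 : ℝ) := by
    have h1 := hρ.mul_le s t hs hst
    rw [← hxdef, ← hydef, ← inv_div s t, Real.inv_rpow (by positivity)] at h1
    rw [div_le_iff₀ hy]
    have hp : 0 < (s / t) ^ (1 / 2 : ℝ) := by positivity
    calc x = (s / t) ^ (1 / 2 : ℝ) * (((s / t) ^ (1 / 2 : ℝ))⁻¹ * x) := by field_simp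
      _ ≤ (s / t) ^ (1 / 2 : ℝ) * (R * y) := by gcongr
      _ = _ := by ring
  have hxyε : (x / y) ^ (η / 2) ≤ R ^ (η / 2) * (s / t) ^ (η / 4) := by
    calc (x / y) ^ (η / 2) ≤ (R * (s / t) ^ (1 / 2 : ℝ)) ^ (η / 2) := by gcongr
      _ = R ^ (η / 2) * (s / t) ^ (η / 4) := by
        rw [Real.mul_rpow hR0.le (by positivity), ← Real.rpow_mul (by positivity)]
        congr 2
        ring
  have hst1 : (s / t) ^ (1 / 2 : ℝ) ≤ 1 :=
    Real.rpow_le_one (by positivity) ((div_le_one ht).2 hst) (by norm_num)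
  have hxR : x / y ≤ R := hxy.trans (mul_le_of_le_one_right hR0.le hst1)
  have hRη : 1 ≤ R ^ η := Real.one_le_rpow hR hη.le
  have hyη : 0 < y ^ η := by positivity
  have key : x ^ η * a x ≤ C * ((x / y) ^ (η / 2) * R ^ η) * (y ^ η * a y) := by
    have hsplit : x ^ η = (x / y) ^ η * y ^ η := by
      rw [← Real.mul_rpow (by positivity) hy.le, div_mul_cancel₀ _ hy.ne']
    -- Since ρ need not be monotone, x > y can occur; in that case x/y ≤ R, and the surplus factor
    -- is absorbed in R^η.
    rcases le_total x y with hle | hle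
    · have e : (x / y) ^ η * (y / x) ^ (η / 2) = (x / y) ^ (η / 2) := by
        rw [← inv_div x y, Real.inv_rpow (by positivity), ← Real.rpow_neg (by positivity),
          ← Real.rpow_add (by positivity)]
        congr 1
        ring
      calc x ^ η * a x ≤ x ^ η * (C * (y / x) ^ (η / 2) * a y) := by
            gcongr; exact (h x y hx hle).1
        _ = C * ((x / y) ^ η * (y / x) ^ (η / 2) * 1) * (y ^ η * a y) := by rw [hsplit]; ring
        _ ≤ _ := by rw [e]; gcongr
    · calc x ^ η * a x ≤ x ^ η * (C * (x / y) ^ (η / 2) * a y) := by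
            gcongr; exact (h y x hy hle).2
        _ = C * ((x / y) ^ (η / 2) * (x / y) ^ η) * (y ^ η * a y) := by rw [hsplit]; ring
        _ ≤ _ := by gcongr
  calc x ^ η * a x ≤ C * ((x / y) ^ (η / 2) * R ^ η) * (y ^ η * a y) := key
    _ ≤ C * (R ^ (η / 2) * (s / t) ^ (η / 4) * R ^ η) * (y ^ η * a y) := by gcongr
    _ = _ := by ring

namespace LimitingParameters

variable {r₁ q₁ : ℝ≥0∞} {b₁ a₁ : ℝ → ℝ} {V : Type*} [AddCommGroup V] {A₀ A₁ : V → ℝ≥0∞}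

/-- The weight of the transformed norms, `ρ(t) ^ (1 - θ) a(ρ(t))`. -/
noncomputable def rhoWeight (r₁ : ℝ≥0∞) (b₁ : ℝ → ℝ) (q₁ : ℝ≥0∞) (a₁ a : ℝ → ℝ) (θ : ℝ) (t : ℝ) :
    ℝ≥0∞ :=
  ENNReal.ofReal (rhoOne r₁ b₁ q₁ a₁ t ^ (1 - θ) * a (rhoOne r₁ b₁ q₁ a₁ t))

theorem measurable_rhoWeight (h : LimitingParameters r₁ b₁ q₁ a₁) {a : ℝ → ℝ} (ha : Measurable a)
    (θ : ℝ) : Measurable (rhoWeight r₁ b₁ q₁ a₁ a θ) := by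
  obtain ⟨R, hR⟩ := h.exists_isRegularVariable
  have hm := hR.measurable
  unfold rhoWeight
  fun_prop

/-- Splitting off 1/ρ = χ₁/t brings the weight into the form in which the Holmstedt-type formula
applies. -/
theorem ofReal_rhoOne_rpow_mul (h : LimitingParameters r₁ b₁ q₁ a₁) (a : ℝ → ℝ) (θ : ℝ) {t : ℝ}
    (ht : 0 < t) :
    ENNReal.ofReal (rhoOne r₁ b₁ q₁ a₁ t ^ (-θ)) * ENNReal.ofReal (a (rhoOne r₁ b₁ q₁ a₁ t)) =
      rhoWeight r₁ b₁ q₁ a₁ a θ t *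
        (ENNReal.ofReal t⁻¹ * chi r₁ (ofRealFun b₁) q₁ (ofRealFun a₁) t) := by
  have hρ := h.rhoOne_pos ht
  have e : rhoOne r₁ b₁ q₁ a₁ t ^ (-θ) =
      rhoOne r₁ b₁ q₁ a₁ t ^ (1 - θ) * (rhoOne r₁ b₁ q₁ a₁ t)⁻¹ := by
    rw [← Real.rpow_neg_one (rhoOne r₁ b₁ q₁ a₁ t), ← Real.rpow_add hρ]
    congr 1
    ring
  rw [← h.ofReal_inv_rhoOne ht, rhoWeight, ENNReal.ofReal_mul (by positivity), mul_right_comm,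
    e, ENNReal.ofReal_mul (by positivity)]

/-- The target space of the interpolation formula in transformed form. -/
theorem stdSpace_aSharp_eq (h : LimitingParameters r₁ b₁ q₁ a₁) {r : ℝ≥0∞} (hr : 0 < r)
    (a : ℝ → ℝ) (θ : ℝ) (f : V) :
    stdSpace A₀ A₁ θ r (aSharp r₁ b₁ q₁ a₁ a θ) f =
      logNorm r (Ioi 0) (fun t => rhoWeight r₁ b₁ q₁ a₁ a θ t *
        (ENNReal.ofReal t⁻¹ * chi r₁ (ofRealFun b₁) q₁ (ofRealFun a₁) t *
          peetreK A₀ A₁ t f)) := by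
  rw [stdSpace, lqNorm_weight_mul hr subset_rfl measurableSet_Ioi]
  refine logNorm_congr measurableSet_Ioi fun t _ ht => ?_
  have hχ := h.chiOne_pos ht
  rw [← mul_assoc, ← h.ofReal_rhoOne_rpow_mul a θ ht, aSharp, ENNReal.ofReal_mul (by positivity),
    ← mul_assoc, ← ENNReal.ofReal_mul (by positivity)]
  congr 3
  rw [rhoOne, Real.div_rpow ht.le hχ.le, Real.rpow_neg hχ.le, div_inv_eq_mul]

theorem spaceR_bigBOne_eq (h : LimitingParameters r₁ b₁ q₁ a₁) {r : ℝ≥0∞} (hr : 0 < r)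
    (a : ℝ → ℝ) (f : V) :
    spaceR A₀ A₁ 1 r (bigBOne r₁ b₁ q₁ a₁ a) q₁ a₁ f =
      logNorm r (Ioi 0) (fun t => rhoWeight r₁ b₁ q₁ a₁ a 1 t *
        (logNorm r₁ (Ioo 0 t) (ofRealFun b₁) *
          tailNorm q₁ (ofRealFun a₁) (fun u => peetreK A₀ A₁ u f) t)) := by
  rw [spaceR, lqNorm_weight_zero_mul hr subset_rfl measurableSet_Ioi]
  refine logNorm_congr measurableSet_Ioi fun t _ ht => ?_
  rw [tailNorm_eq h.q_pos a₁ _ ht.le, bigBOne, ENNReal.ofReal_mul ENNReal.toReal_nonneg,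
    lqNorm_weight_zero h.r_pos Ioo_subset_Ioi_self measurableSet_Ioo,
    ENNReal.ofReal_toReal (h.logNorm_ne_top ht), rhoWeight, sub_self, Real.rpow_zero, one_mul]
  ring

theorem spaceRR_eq (h : LimitingParameters r₁ b₁ q₁ a₁) {r : ℝ≥0∞} (hr : 0 < r)
    (a : ℝ → ℝ) (f : V) :
    spaceRR A₀ A₁ 1 r (a ∘ rhoOne r₁ b₁ q₁ a₁) r₁ b₁ q₁ a₁ f =
      logNorm r (Ioi 0) (fun t => rhoWeight r₁ b₁ q₁ a₁ a 1 t *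
        iteratedTailNorm r₁ (ofRealFun b₁) q₁ (ofRealFun a₁) (fun u => peetreK A₀ A₁ u f) t) := by
  rw [spaceRR, lqNorm_weight_zero_mul hr subset_rfl measurableSet_Ioi]
  refine logNorm_congr measurableSet_Ioi fun t _ ht => ?_
  rw [iteratedTailNorm_eq h.r_pos h.q_pos b₁ a₁ _ ht.le, rhoWeight, sub_self, Real.rpow_zero,
    one_mul, Function.comp]

/-- The change of variables `v = ρ(t)` in the norm of `(A₀, X)_{θ,r;a}`. -/
theorem exists_stdSpace_equiv_comp (h : LimitingParameters r₁ b₁ q₁ a₁) {r : ℝ≥0∞} (hr : 0 < r)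
    {a : ℝ → ℝ} (ha : IsSlowlyVarying a) (ham : Measurable a) (θ : ℝ) (A₀ X : V → ℝ≥0∞) :
    ∃ C : ℝ≥0, ∀ f : V,
      stdSpace A₀ X θ r a f ≤ C * logNorm r (Ioi 0) (fun t => rhoWeight r₁ b₁ q₁ a₁ a θ t *
        (ENNReal.ofReal t⁻¹ * chi r₁ (ofRealFun b₁) q₁ (ofRealFun a₁) t *
          peetreK A₀ X (rhoOne r₁ b₁ q₁ a₁ t) f)) ∧
      logNorm r (Ioi 0) (fun t => rhoWeight r₁ b₁ q₁ a₁ a θ t *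
        (ENNReal.ofReal t⁻¹ * chi r₁ (ofRealFun b₁) q₁ (ofRealFun a₁) t *
          peetreK A₀ X (rhoOne r₁ b₁ q₁ a₁ t) f)) ≤ C * stdSpace A₀ X θ r a f := by
  obtain ⟨R, hR⟩ := h.exists_isRegularVariable
  have hR1 := hR.one_le
  obtain ⟨D, hD⟩ := ((PowerBound.rpow (-θ)).mul (ha.powerBound one_pos)).exists_le_of_le_mul (4 * R)
  -- The integrand is almost constant at arguments of bounded ratio, which both directions of the
  -- change of variables require.
  have hF : ∀ (f : V) (v w : ℝ), 0 < v → 0 < w → v ≤ 4 * R * w → w ≤ 4 * R * v →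
      ENNReal.ofReal (v ^ (-θ)) * ENNReal.ofReal (a v) * peetreK A₀ X v f ≤
        (D * Real.toNNReal (4 * R) : ℝ≥0) *
          (ENNReal.ofReal (w ^ (-θ)) * ENNReal.ofReal (a w) * peetreK A₀ X w f) := by
    intro f v w hv hw hvw hwv
    calc _ ≤ (D * (ENNReal.ofReal (w ^ (-θ)) * ENNReal.ofReal (a w))) *
          (ENNReal.ofReal (4 * R) * peetreK A₀ X w f) :=
          mul_le_mul' (hD v w hv hw hvw hwv) (peetreK_le_mul A₀ X f (by linarith) hvw)
      _ = _ := by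
          rw [ENNReal.coe_mul]
          change _ = (D : ℝ≥0∞) * ENNReal.ofReal (4 * R) * _
          ring
  obtain ⟨C₁, h₁⟩ := hR.exists_logNorm_comp_le hr (D * Real.toNNReal (4 * R))
  obtain ⟨C₂, h₂⟩ := hR.exists_logNorm_le_comp hr (D * Real.toNNReal (4 * R))
  refine ⟨C₁ + C₂, fun f => ?_⟩
  have hm : Measurable fun v => ENNReal.ofReal (v ^ (-θ)) * ENNReal.ofReal (a v) *
      peetreK A₀ X v f := by fun_prop
  have e₁ : stdSpace A₀ X θ r a f = logNorm r (Ioi 0)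
      (fun v => ENNReal.ofReal (v ^ (-θ)) * ENNReal.ofReal (a v) * peetreK A₀ X v f) := by
    rw [stdSpace, lqNorm_weight_mul hr subset_rfl measurableSet_Ioi]
  have e₂ : logNorm r (Ioi 0) (fun t => rhoWeight r₁ b₁ q₁ a₁ a θ t *
        (ENNReal.ofReal t⁻¹ * chi r₁ (ofRealFun b₁) q₁ (ofRealFun a₁) t *
          peetreK A₀ X (rhoOne r₁ b₁ q₁ a₁ t) f)) = logNorm r (Ioi 0)
      (fun t => ENNReal.ofReal (rhoOne r₁ b₁ q₁ a₁ t ^ (-θ)) *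
        ENNReal.ofReal (a (rhoOne r₁ b₁ q₁ a₁ t)) * peetreK A₀ X (rhoOne r₁ b₁ q₁ a₁ t) f) :=
    logNorm_congr measurableSet_Ioi fun t _ ht => by
      rw [h.ofReal_rhoOne_rpow_mul a θ ht, ← mul_assoc]
  rw [e₁, e₂]
  constructor
  · refine (h₂ _ hm (hF f)).trans (mul_le_mul_left ?_ _)
    exact_mod_cast le_add_self
  · refine (h₁ _ hm fun v w hv hw => ?_).trans (mul_le_mul_left ?_ _)
    · have hw0 := hv.trans hw.1
      exact hF f v w hv hw0 (by nlinarith [hw.1]) (by nlinarith [hw.2])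
    · exact_mod_cast le_self_add

/-- Hardy-type domination of the tail terms when `θ < 1`. -/
theorem exists_tail_terms_le (h : LimitingParameters r₁ b₁ q₁ a₁) {r : ℝ≥0∞} (hr : 0 < r)
    {a : ℝ → ℝ} (ha : IsSlowlyVarying a) (ham : Measurable a) {θ : ℝ} (hθ : θ < 1)
    (A₀ A₁ : V → ℝ≥0∞) :
    ∃ C : ℝ≥0, ∀ f : V,
      logNorm r (Ioi 0) (fun t => rhoWeight r₁ b₁ q₁ a₁ a θ t *
        (logNorm r₁ (Ioo 0 t) (ofRealFun b₁) *
          tailNorm q₁ (ofRealFun a₁) (fun u => peetreK A₀ A₁ u f) t)) ≤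
        C * stdSpace A₀ A₁ θ r (aSharp r₁ b₁ q₁ a₁ a θ) f ∧
      logNorm r (Ioi 0) (fun t => rhoWeight r₁ b₁ q₁ a₁ a θ t *
        iteratedTailNorm r₁ (ofRealFun b₁) q₁ (ofRealFun a₁) (fun u => peetreK A₀ A₁ u f) t) ≤
        C * stdSpace A₀ A₁ θ r (aSharp r₁ b₁ q₁ a₁ a θ) f := by
  obtain ⟨R, hR⟩ := h.exists_isRegularVariable
  have hη : 0 < 1 - θ := sub_pos.2 hθ
  obtain ⟨c, hc⟩ := ha.exists_rpow_mul_comp_le hR hη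
  obtain ⟨D₁, hD₁⟩ := ((PowerBound.rpow (-1)).mul
    (h.slow_a.powerBound one_pos)).exists_le_of_le_mul 2
  obtain ⟨D₂, hD₂⟩ := (h.slow_b.powerBound one_pos).exists_le_of_le_mul 2
  simp only [Real.rpow_neg_one] at hD₁
  obtain ⟨C₁, h₁⟩ := exists_hardy hr q₁ (by positivity : 0 < (1 - θ) / 4) c D₁
  obtain ⟨C₂, h₂⟩ := exists_hardy hr r₁ (by positivity : 0 < (1 - θ) / 4) c (D₂ * D₁)
  obtain ⟨C₃, h₃⟩ := h.exists_mul_logNorm_le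
  obtain ⟨C₄, h₄⟩ := h.exists_le_logNorm
  have hΨ := h.measurable_rhoWeight ham θ
  have hB : Measurable fun t => logNorm r₁ (Ioo 0 t) (ofRealFun b₁) :=
    Monotone.measurable fun _ _ hst => logNorm_mono_set (Ioo_subset_Ioo_right hst)
  have ha₁m := h.slow_a.aemeasurable
  have hb₁m := h.slow_b.aemeasurable
  have main : ∀ f : V, logNorm r (Ioi 0) (fun t => rhoWeight r₁ b₁ q₁ a₁ a θ t *
        (logNorm r₁ (Ioo 0 t) (ofRealFun b₁) *
          tailNorm q₁ (ofRealFun a₁) (fun u => peetreK A₀ A₁ u f) t)) ≤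
        (C₁ * C₃ : ℝ≥0) * stdSpace A₀ A₁ θ r (aSharp r₁ b₁ q₁ a₁ a θ) f ∧
      ∀ u v : ℝ, 0 < u → u ≤ v → v ≤ 2 * u →
        ENNReal.ofReal u⁻¹ * ofRealFun a₁ u * peetreK A₀ A₁ u f ≤
          D₁ * (ENNReal.ofReal v⁻¹ * ofRealFun a₁ v * peetreK A₀ A₁ v f) := by
    intro f
    have hG : ∀ u v : ℝ, 0 < u → u ≤ v → v ≤ 2 * u →
        ENNReal.ofReal u⁻¹ * ofRealFun a₁ u * peetreK A₀ A₁ u f ≤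
          D₁ * (ENNReal.ofReal v⁻¹ * ofRealFun a₁ v * peetreK A₀ A₁ v f) := by
      intro u v hu huv hvu
      rw [← mul_assoc]
      exact mul_le_mul' (hD₁ u v hu (hu.trans_le huv) (by linarith) hvu)
        (monotone_peetreK A₀ A₁ f huv)
    refine ⟨?_, hG⟩
    -- The factor ‖b₁‖_{r₁,(0,t)} is non-decreasing and does not spoil the growth of the weight.
    -- After Hardy, a₁(t) ‖b₁‖_{r₁,(0,t)} ≤ C χ₁(t) recovers the norm with a#.
    have key := h₁ (fun t => rhoWeight r₁ b₁ q₁ a₁ a θ t * logNorm r₁ (Ioo 0 t) (ofRealFun b₁))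
      (fun u => ENNReal.ofReal u⁻¹ * ofRealFun a₁ u * peetreK A₀ A₁ u f) (by fun_prop)
      (by fun_prop) (fun s t hs hst => ?_) (fun u v hu hv => hG u v hu hv.1.le hv.2.le)
    · simp only [mul_assoc] at key
      simp only [tailNorm, mul_assoc]
      refine key.trans ?_
      rw [ENNReal.coe_mul, mul_assoc, h.stdSpace_aSharp_eq hr a θ f]
      refine mul_le_mul_right (logNorm_mono_const_mul measurableSet_Ioi ENNReal.coe_ne_top
        fun t _ ht => ?_) _
      calc rhoWeight r₁ b₁ q₁ a₁ a θ t * (logNorm r₁ (Ioo 0 t) (ofRealFun b₁) *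
            (ENNReal.ofReal t⁻¹ * (ofRealFun a₁ t * peetreK A₀ A₁ t f)))
          = rhoWeight r₁ b₁ q₁ a₁ a θ t * ENNReal.ofReal t⁻¹ * peetreK A₀ A₁ t f *
            (ofRealFun a₁ t * logNorm r₁ (Ioo 0 t) (ofRealFun b₁)) := by ring
        _ ≤ rhoWeight r₁ b₁ q₁ a₁ a θ t * ENNReal.ofReal t⁻¹ * peetreK A₀ A₁ t f *
            (C₃ * chi r₁ (ofRealFun b₁) q₁ (ofRealFun a₁) t) := mul_le_mul_right (h₃ t ht) _
        _ = _ := by ring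
    · rw [← mul_assoc]
      exact mul_le_mul' (hc s t hs hst) (logNorm_mono_set (Ioo_subset_Ioo_right hst))
  refine ⟨C₁ * C₃ * (1 + C₂ * C₄), fun f => ?_⟩
  obtain ⟨hfirst, hG⟩ := main f
  have htail : ∀ u v : ℝ, 0 < u → v ∈ Ioo u (2 * u) →
      tailNorm q₁ (ofRealFun a₁) (fun u => peetreK A₀ A₁ u f) u ≤
        D₁ * tailNorm q₁ (ofRealFun a₁) (fun u => peetreK A₀ A₁ u f) v := by
    -- As v < 2u, the tail from v dominates the tail from 2u; dilation by 1/2 compares the latter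
    -- with the tail from u.
    intro u v hu hv
    refine le_trans ?_ (mul_le_mul_right (antitone_logNorm_Ioi q₁ _ hv.2.le) _)
    have e := logNorm_Ioi_mul (q := q₁) (one_half_pos (α := ℝ)) (2 * u)
      (fun u => ENNReal.ofReal u⁻¹ * ofRealFun a₁ u * peetreK A₀ A₁ u f)
    rw [one_div, inv_mul_cancel_left₀ (two_ne_zero' ℝ)] at e
    rw [tailNorm, e]
    exact logNorm_mono_const_mul measurableSet_Ioi ENNReal.coe_ne_top fun w _ hw =>
      hG _ w (by positivity) (by linarith) (by linarith)
  -- A second application of Hardy, now to the outer norm, removes one tail; b₁(t) ≤ C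
  -- ‖b₁‖_{r₁,(0,t)} then reduces to the term already bounded.
  have key := h₂ (rhoWeight r₁ b₁ q₁ a₁ a θ) (fun s => ofRealFun b₁ s *
    tailNorm q₁ (ofRealFun a₁) (fun u => peetreK A₀ A₁ u f) s) hΨ.aemeasurable (by fun_prop) hc
    (fun u v hu hv => ?_)
  · have hsecond : logNorm r (Ioi 0) (fun u => rhoWeight r₁ b₁ q₁ a₁ a θ u *
        (ofRealFun b₁ u * tailNorm q₁ (ofRealFun a₁) (fun u => peetreK A₀ A₁ u f) u)) ≤
        C₄ * logNorm r (Ioi 0) (fun t => rhoWeight r₁ b₁ q₁ a₁ a θ t *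
        (logNorm r₁ (Ioo 0 t) (ofRealFun b₁) *
          tailNorm q₁ (ofRealFun a₁) (fun u => peetreK A₀ A₁ u f) t)) := by
      refine logNorm_mono_const_mul measurableSet_Ioi ENNReal.coe_ne_top fun t _ ht => ?_
      refine (mul_le_mul_right (mul_le_mul_left (h₄ t ht) _) _).trans_eq ?_
      ring
    have hthird := key.trans (mul_le_mul_right (hsecond.trans (mul_le_mul_right hfirst _)) _)
    generalize stdSpace A₀ A₁ θ r (aSharp r₁ b₁ q₁ a₁ a θ) f = y at *
    constructor
    · refine hfirst.trans (mul_le_mul_left ?_ _)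
      exact ENNReal.coe_le_coe.2 (le_mul_of_one_le_right' le_self_add)
    · refine hthird.trans ?_
      calc (C₂ : ℝ≥0∞) * (C₄ * ((C₁ * C₃ : ℝ≥0) * y))
          ≤ C₂ * (C₄ * ((C₁ * C₃ : ℝ≥0) * y)) + C₁ * C₃ * y := le_self_add
        _ = _ := by push_cast; ring
  · calc ofRealFun b₁ u * tailNorm q₁ (ofRealFun a₁) (fun u => peetreK A₀ A₁ u f) u
        ≤ (D₂ * ofRealFun b₁ v) *
          (D₁ * tailNorm q₁ (ofRealFun a₁) (fun u => peetreK A₀ A₁ u f) v) :=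
        mul_le_mul' (hD₂ u v hu (hu.trans hv.1) (by linarith [hv.1]) hv.2.le) (htail u v hu hv)
      _ = _ := by push_cast; ring

variable {𝕜 : Type*} [RCLike 𝕜] [Module 𝕜 V] [TopologicalSpace V]

/-- The norm of the interpolation space is equivalent to the sum of three weighted norms. -/
theorem exists_stdSpace_equiv (h : LimitingParameters r₁ b₁ q₁ a₁)
    (hA₀ : IsQuasiBanachSubspace 𝕜 A₀) (hA₁ : IsQuasiBanachSubspace 𝕜 A₁)
    {r : ℝ≥0∞} (hr : 0 < r) {a : ℝ → ℝ} (ha : IsSlowlyVarying a) (ham : Measurable a) (θ : ℝ) :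
    ∃ C : ℝ≥0, ∀ f : V,
      stdSpace A₀ (spaceR A₀ A₁ 1 r₁ b₁ q₁ a₁) θ r a f ≤
        C * (stdSpace A₀ A₁ θ r (aSharp r₁ b₁ q₁ a₁ a θ) f +
          logNorm r (Ioi 0) (fun t => rhoWeight r₁ b₁ q₁ a₁ a θ t *
            (logNorm r₁ (Ioo 0 t) (ofRealFun b₁) *
              tailNorm q₁ (ofRealFun a₁) (fun u => peetreK A₀ A₁ u f) t)) +
          logNorm r (Ioi 0) (fun t => rhoWeight r₁ b₁ q₁ a₁ a θ t *
            iteratedTailNorm r₁ (ofRealFun b₁) q₁ (ofRealFun a₁)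
              (fun u => peetreK A₀ A₁ u f) t)) ∧
      stdSpace A₀ A₁ θ r (aSharp r₁ b₁ q₁ a₁ a θ) f ≤
        C * stdSpace A₀ (spaceR A₀ A₁ 1 r₁ b₁ q₁ a₁) θ r a f ∧
      logNorm r (Ioi 0) (fun t => rhoWeight r₁ b₁ q₁ a₁ a θ t *
        (logNorm r₁ (Ioo 0 t) (ofRealFun b₁) *
          tailNorm q₁ (ofRealFun a₁) (fun u => peetreK A₀ A₁ u f) t)) ≤
        C * stdSpace A₀ (spaceR A₀ A₁ 1 r₁ b₁ q₁ a₁) θ r a f ∧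
      logNorm r (Ioi 0) (fun t => rhoWeight r₁ b₁ q₁ a₁ a θ t *
        iteratedTailNorm r₁ (ofRealFun b₁) q₁ (ofRealFun a₁) (fun u => peetreK A₀ A₁ u f) t) ≤
        C * stdSpace A₀ (spaceR A₀ A₁ 1 r₁ b₁ q₁ a₁) θ r a f := by
  obtain ⟨C₁, h₁⟩ := h.exists_stdSpace_equiv_comp hr ha ham θ A₀ (spaceR A₀ A₁ 1 r₁ b₁ q₁ a₁)
  obtain ⟨C₂, h₂⟩ := h.exists_holmstedt hA₀ hA₁
  obtain ⟨l, hl⟩ : ∃ l : ℝ≥0, ENNReal.LpAddConst r = l :=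
    ⟨_, (ENNReal.coe_toNNReal (ENNReal.LpAddConst_lt_top r).ne).symm⟩
  refine ⟨C₁ * C₂ * (1 + l * (1 + l)), fun f => ?_⟩
  obtain ⟨h₁₁, h₁₂⟩ := h₁ f
  have hΨ := h.measurable_rhoWeight ham θ
  have hB : Measurable fun t => logNorm r₁ (Ioo 0 t) (ofRealFun b₁) :=
    Monotone.measurable fun _ _ hst => logNorm_mono_set (Ioo_subset_Ioo_right hst)
  have hχ : Measurable (chi r₁ (ofRealFun b₁) q₁ (ofRealFun a₁)) := monotone_chi.measurable
  rw [h.stdSpace_aSharp_eq hr a θ f]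
  set Ψ := rhoWeight r₁ b₁ q₁ a₁ a θ with hΨdef
  set P : ℝ → ℝ≥0∞ := fun t => Ψ t *
    (ENNReal.ofReal t⁻¹ * chi r₁ (ofRealFun b₁) q₁ (ofRealFun a₁) t * peetreK A₀ A₁ t f) with hP
  set Q : ℝ → ℝ≥0∞ := fun t => Ψ t * (logNorm r₁ (Ioo 0 t) (ofRealFun b₁) *
    tailNorm q₁ (ofRealFun a₁) (fun u => peetreK A₀ A₁ u f) t) with hQ
  set T : ℝ → ℝ≥0∞ := fun t => Ψ t * iteratedTailNorm r₁ (ofRealFun b₁) q₁ (ofRealFun a₁)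
    (fun u => peetreK A₀ A₁ u f) t with hT
  set Z : ℝ → ℝ≥0∞ := fun t => Ψ t *
    (ENNReal.ofReal t⁻¹ * chi r₁ (ofRealFun b₁) q₁ (ofRealFun a₁) t *
      peetreK A₀ (spaceR A₀ A₁ 1 r₁ b₁ q₁ a₁) (rhoOne r₁ b₁ q₁ a₁ t) f) with hZ
  have hPm : Measurable P := by fun_prop
  have hQm : Measurable Q := by fun_prop
  have hTm : Measurable T := by fun_prop
  have hupper : logNorm r (Ioi 0) Z ≤ C₂ * logNorm r (Ioi 0) (fun t => P t + Q t + T t) := by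
    refine logNorm_mono_const_mul measurableSet_Ioi ENNReal.coe_ne_top fun t _ ht => ?_
    refine (mul_le_mul_right (h₂ f t ht).1 _).trans_eq ?_
    simp only [hP, hQ, hT]
    ring
  have hlower : logNorm r (Ioi 0) (fun t => P t + Q t + T t) ≤ C₂ * logNorm r (Ioi 0) Z := by
    refine logNorm_mono_const_mul measurableSet_Ioi ENNReal.coe_ne_top fun t _ ht => ?_
    calc P t + Q t + T t = Ψ t * _ := by simp only [hP, hQ, hT, ← mul_add]
      _ ≤ _ := mul_le_mul_right (h₂ f t ht).2 (Ψ t)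
      _ = _ := by simp only [hZ]; ring
  have hsum : logNorm r (Ioi 0) (fun t => P t + Q t + T t) ≤
      (1 + l * (1 + l) : ℝ≥0) *
        (logNorm r (Ioi 0) P + logNorm r (Ioi 0) Q + logNorm r (Ioi 0) T) := by
    have e1 : logNorm r (Ioi 0) (fun t => P t + Q t + T t) ≤
        l * (logNorm r (Ioi 0) (fun t => P t + Q t) + logNorm r (Ioi 0) T) :=
      hl ▸ logNorm_add_le (hPm.add hQm).aemeasurable hTm.aemeasurable
    have e2 : logNorm r (Ioi 0) (fun t => P t + Q t) ≤
        l * (logNorm r (Ioi 0) P + logNorm r (Ioi 0) Q) :=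
      hl ▸ logNorm_add_le hPm.aemeasurable hQm.aemeasurable
    generalize logNorm r (Ioi 0) P = p at *
    generalize logNorm r (Ioi 0) Q = q at *
    generalize logNorm r (Ioi 0) T = τ at *
    calc _ ≤ (l : ℝ≥0∞) * (l * (p + q) + τ) :=
          e1.trans (mul_le_mul_right (add_le_add_left e2 _) _)
      _ ≤ l * (l * (p + q + τ) + (p + q + τ)) :=
          mul_le_mul_right (add_le_add (mul_le_mul_right le_self_add _) le_add_self) _
      _ ≤ l * (l * (p + q + τ) + (p + q + τ)) + (p + q + τ) := le_self_add
      _ = _ := by push_cast; ring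
  have hone : logNorm r (Ioi 0) (fun t => P t + Q t + T t) ≤
      (C₁ * C₂ * (1 + l * (1 + l)) : ℝ≥0) *
        stdSpace A₀ (spaceR A₀ A₁ 1 r₁ b₁ q₁ a₁) θ r a f := by
    generalize stdSpace A₀ (spaceR A₀ A₁ 1 r₁ b₁ q₁ a₁) θ r a f = y at *
    calc _ ≤ C₂ * (C₁ * y) := hlower.trans (mul_le_mul_right h₁₂ _)
      _ ≤ C₂ * (C₁ * y) + C₂ * (C₁ * y) * (l * (1 + l)) := le_self_add
      _ = _ := by push_cast; ring
  refine ⟨?_, le_trans (logNorm_mono measurableSet_Ioi fun t _ _ => ?_) hone,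
    le_trans (logNorm_mono measurableSet_Ioi fun t _ _ => ?_) hone,
    le_trans (logNorm_mono measurableSet_Ioi fun t _ _ => ?_) hone⟩
  · refine h₁₁.trans ((mul_le_mul_right (hupper.trans (mul_le_mul_right hsum _)) _).trans_eq ?_)
    push_cast
    ring
  · exact le_self_add.trans le_self_add
  · exact le_add_self.trans le_self_add
  · exact le_add_self

theorem sameSpace_of_lt_one (h : LimitingParameters r₁ b₁ q₁ a₁)
    (hA₀ : IsQuasiBanachSubspace 𝕜 A₀) (hA₁ : IsQuasiBanachSubspace 𝕜 A₁)
    {r : ℝ≥0∞} (hr : 0 < r) {a : ℝ → ℝ} (ha : IsSlowlyVarying a) (ham : Measurable a)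
    {θ : ℝ} (hθ : θ < 1) :
    SameSpace (stdSpace A₀ (spaceR A₀ A₁ 1 r₁ b₁ q₁ a₁) θ r a)
      (stdSpace A₀ A₁ θ r (aSharp r₁ b₁ q₁ a₁ a θ)) := by
  obtain ⟨C, hC⟩ := h.exists_stdSpace_equiv hA₀ hA₁ hr ha ham θ
  obtain ⟨D, hD⟩ := h.exists_tail_terms_le hr ha ham hθ A₀ A₁
  refine ⟨⟨C, fun f _ => (hC f).2.1⟩, ⟨C * (1 + D + D), fun f _ => ?_⟩⟩
  refine (hC f).1.trans ((mul_le_mul_right (add_le_add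
    (add_le_add_right (hD f).1 _) (hD f).2) _).trans_eq ?_)
  push_cast
  ring

/-- At θ = 1 the weight is a ∘ ρ with no power of ρ, so Hardy's inequality is not available to
remove the tail terms; they are the norms of the two limiting spaces. The sum of three terms is at
most three times their maximum. -/
theorem sameSpace_one (h : LimitingParameters r₁ b₁ q₁ a₁)
    (hA₀ : IsQuasiBanachSubspace 𝕜 A₀) (hA₁ : IsQuasiBanachSubspace 𝕜 A₁)
    {r : ℝ≥0∞} (hr : 0 < r) {a : ℝ → ℝ} (ha : IsSlowlyVarying a) (ham : Measurable a) :
    SameSpace (stdSpace A₀ (spaceR A₀ A₁ 1 r₁ b₁ q₁ a₁) 1 r a)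
      (interSpace (stdSpace A₀ A₁ 1 r (aSharp r₁ b₁ q₁ a₁ a 1))
        (interSpace (spaceR A₀ A₁ 1 r (bigBOne r₁ b₁ q₁ a₁ a) q₁ a₁)
          (spaceRR A₀ A₁ 1 r (a ∘ rhoOne r₁ b₁ q₁ a₁) r₁ b₁ q₁ a₁))) := by
  obtain ⟨C, hC⟩ := h.exists_stdSpace_equiv hA₀ hA₁ hr ha ham 1
  simp only [← h.spaceR_bigBOne_eq hr a, ← h.spaceRR_eq hr a] at hC
  refine ⟨⟨C, fun f _ => max_le (hC f).2.1 (max_le (hC f).2.2.1 (hC f).2.2.2)⟩,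
    ⟨C * 3, fun f _ => (hC f).1.trans ?_⟩⟩
  rw [ENNReal.coe_mul, mul_assoc]
  refine mul_le_mul_right ?_ _
  have e : ∀ x y z : ℝ≥0∞, x + y + z ≤ ((3 : ℝ≥0) : ℝ≥0∞) * max x (max y z) := by
    intro x y z
    calc x + y + z ≤ max x (max y z) + max x (max y z) + max x (max y z) :=
          add_le_add (add_le_add (le_max_left _ _) ((le_max_left _ _).trans (le_max_right _ _)))
            ((le_max_right _ _).trans (le_max_right _ _))
      _ = _ := by push_cast; ring
  exact e _ _ _

end LimitingParameters

/-! ### Assembly of the three cases. -/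

theorem theorem40 {𝕜 : Type*} [RCLike 𝕜] {V : Type*} [AddCommGroup V] [Module 𝕜 V]
    [TopologicalSpace V] [IsTopologicalAddGroup V] [ContinuousSMul 𝕜 V] [T2Space V]
    (A₀ A₁ : V → ℝ≥0∞)
    (hA₀ : IsQuasiBanachSubspace 𝕜 A₀) (hA₁ : IsQuasiBanachSubspace 𝕜 A₁)
    (hA : ∃ f : V, f ≠ 0 ∧ A₀ f < ∞ ∧ A₁ f < ∞)
    (q₁ r₁ r : ℝ≥0∞) (hq₁ : 0 < q₁) (hr₁ : 0 < r₁) (hr : 0 < r)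
    (a₁ b₁ a : ℝ → ℝ)
    (ha₁ : IsSlowlyVarying a₁) (hb₁ : IsSlowlyVarying b₁) (ha : IsSlowlyVarying a)
    (hfin : lqNorm r₁ (Ioo 0 1)
      (fun s => weight 0 r₁ b₁ s * lqNorm q₁ (Ioo s 1) (weight 0 q₁ a₁)) < ∞) :
    (∀ θ : ℝ, 0 < θ → θ < 1 →
      SameSpace (stdSpace A₀ (spaceR A₀ A₁ 1 r₁ b₁ q₁ a₁) θ r a)
        (stdSpace A₀ A₁ θ r (aSharp r₁ b₁ q₁ a₁ a θ))) ∧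
    (lqNorm r (Ioi 1) (weight 0 r a) < ∞ →
      SameSpace (stdSpace A₀ (spaceR A₀ A₁ 1 r₁ b₁ q₁ a₁) 0 r a)
        (stdSpace A₀ A₁ 0 r (a ∘ rhoOne r₁ b₁ q₁ a₁))) ∧
    (lqNorm r (Ioo 0 1) (weight 0 r a) < ∞ →
      SameSpace (stdSpace A₀ (spaceR A₀ A₁ 1 r₁ b₁ q₁ a₁) 1 r a)
        (interSpace (stdSpace A₀ A₁ 1 r (aSharp r₁ b₁ q₁ a₁ a 1))
          (interSpace (spaceR A₀ A₁ 1 r (bigBOne r₁ b₁ q₁ a₁ a) q₁ a₁)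
            (spaceRR A₀ A₁ 1 r (a ∘ rhoOne r₁ b₁ q₁ a₁) r₁ b₁ q₁ a₁)))) := by
  have h : LimitingParameters r₁ b₁ q₁ a₁ := ⟨hr₁, hq₁, hb₁, ha₁, hfin⟩
  -- The weight `a` is composed with ρ, so it is first replaced by an equivalent Borel function; all
  -- spaces involved depend on it only up to equivalence.
  obtain ⟨a', ha', ham, haa'⟩ := ha.exists_measurable
  have hcomp : EquivOnPos (a' ∘ rhoOne r₁ b₁ q₁ a₁) (a ∘ rhoOne r₁ b₁ q₁ a₁) :=
    haa'.symm.comp fun _ => h.rhoOne_pos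
  have hsharp : ∀ θ : ℝ, EquivOnPos (aSharp r₁ b₁ q₁ a₁ a' θ) (aSharp r₁ b₁ q₁ a₁ a θ) :=
    fun θ => hcomp.mul_left fun t ht => Real.rpow_nonneg (h.chiOne_pos ht).le θ
  have hbig : EquivOnPos (bigBOne r₁ b₁ q₁ a₁ a') (bigBOne r₁ b₁ q₁ a₁ a) :=
    hcomp.mul_left fun _ _ => ENNReal.toReal_nonneg
  have hlt : ∀ θ : ℝ, θ < 1 → SameSpace (stdSpace A₀ (spaceR A₀ A₁ 1 r₁ b₁ q₁ a₁) θ r a)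
      (stdSpace A₀ A₁ θ r (aSharp r₁ b₁ q₁ a₁ a θ)) := fun θ hθ =>
    (sameSpace_stdSpace _ _ haa' θ r).trans
      ((h.sameSpace_of_lt_one hA₀ hA₁ hr ha' ham hθ).trans
        (sameSpace_stdSpace _ _ (hsharp θ) θ r))
  refine ⟨fun θ _ hθ => hlt θ hθ, fun _ => ?_, fun _ => ?_⟩
  -- The case θ = 0 falls under θ < 1, the factor χ₁^0 being 1.
  · have e : aSharp r₁ b₁ q₁ a₁ a 0 = a ∘ rhoOne r₁ b₁ q₁ a₁ := by
      funext t
      simp [aSharp]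
    exact e ▸ hlt 0 one_pos
  · exact (sameSpace_stdSpace _ _ haa' 1 r).trans
      ((h.sameSpace_one hA₀ hA₁ hr ha' ham).trans
        ((sameSpace_stdSpace _ _ (hsharp 1) 1 r).inter
          ((sameSpace_spaceR _ _ hbig 1 r q₁ a₁).inter
            (sameSpace_spaceRR _ _ hcomp 1 r r₁ q₁ b₁ a₁))))
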